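/- Theorem (Gondard–Marshall). Let $n\ge 1$ and let $(X',G')$ be an abstract space of signatures of exponent $2^n$. That is: $G'$ is an abelian group with $g^{2^n}=1$ for all $g\in G'$ and a distinguished element $-1$; and $X'\subseteq \mathrm{Hom}(G',\mu_{2^n})$ is a subset, closed for the topology of pointwise convergence, such that - $\sigma^k\in X'$ for $\sigma\in X'$ and $k$ odd, - $\sigma(-1)=-1$ for all $\sigma\in X'$, - $\bigcap_{\sigma\in X'}\ker\sigma=\{1\}$, - $D(f\oplus g)=\bigcup\{D\langle x,y\rangle : x\in D(f),\ y\in D(g)\}$ for all forms $f,g$ over $G'$ of dimension $\ge 1$. Here a form is a tuple $f=\langle a_1,\dots,a_k\rangle$ of elements of $G'$. We write $f\equiv g$ if $f=\langle a_1,\dots,a_k\rangle$ and $g=\langle b_1,\dots,b_k\rangle$ have the same dimension and $\sum_i\sigma(a_i)=\sum_i\sigma(b_i)$ for all $\sigma\in X'$, and $D(f)$ is the set of $a\in G'$ such that $f\equiv\langle a\rangle\oplus h$ for some form $h$ (possibly of dimension $0$). A space of orderings is a space of signatures of exponent $2$. For a set $Y$ of characters of $G'$ put $Y^\perp=\bigcap_{\sigma\in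 Y}\ker\sigma$. A subspace of $(X',G')$ is a pair $(X,G)$ with $X=\{\sigma\in X' : \sigma|_\Delta=1\}$ for some subgroup $\Delta$ of $G'$ and $G=G'/X^\perp$. Let $(X,G)$ be a subspace of $(X',G')$ that is a space of orderings, i.e. $\sigma^2=1$ for all $\sigma\in X$. For $\sigma,\tau\in X$ write $\sigma\sim\tau$ if $\sigma\tau=\rho^2$ for some $\rho\in X'$. A subset $Y\subseteq X$ is called a fan if $(Y,G'/Y^\perp)$ is a space of orderings and $Y$ is the set of all characters $\sigma$ of $G'/Y^\perp$ with $\sigma(-1)=-1$. A $P$-structure on $X$ is an equivalence relation on $X$ such that every equivalence class is a fan and such that, whenever $\sigma_0,\sigma_1,\sigma_2,\sigma_3\in X$ and $\sigma_0\sigma_1\sigma_2\sigma_3=1$, the set $\{\sigma_0,\sigma_1,\sigma_2,\sigma_3\}$ meets at most two equivalence classes. Then the following are equivalent: 1. $\sim$ is an equivalence relation and a $P$-structure on $X$. 2. Whenever $\sigma_0,\sigma_1,\sigma_2,\sigma_3\in X$ satisfy $\sigma_0\sigma_1\sigma_2\sigma_3=1$, either $\sigma_0$ is related by $\sim$ to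 exactly one of $\sigma_1,\sigma_2,\sigma_3$, or $\sigma_0$ is related by $\sim$ to all three of them. Moreover, in this case the quotient space $X/{\sim}$, with the quotient topology, is Hausdorff. -/

import Mathlib

namespace SignatureSpaces

/-- The character group `χ(G)` of an abelian group `G`.  If `G` has exponent `2 ^ n`, every
character takes its values in the group `μ_{2 ^ n}` of `2 ^ n`-th roots of unity, so that this is
`Hom(G, μ_{2 ^ n})` (and `Hom(G, {1, -1})` for `n = 1`). -/
noncomputable abbrev Character (G : Type*) [CommGroup G] := G →* Circle

/-- The topology of pointwise convergence on the character group. -/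
noncomputable instance characterTopology {G : Type*} [CommGroup G] : TopologicalSpace (Character G) :=
  TopologicalSpace.induced (fun (σ : Character G) (g : G) => σ g) inferInstance

/-- The signature `σ(a₁) + ⋯ + σ(a_k)` of the form `⟨a₁, …, a_k⟩` at the character `σ`.
Forms are lists of elements of `G`, and the orthogonal sum `f ⊕ g` is `f ++ g`. -/
noncomputable def sgn {G : Type*} [CommGroup G] (σ : Character G) (f : List G) : ℂ :=
  (f.map fun a => ((σ a : Circle) : ℂ)).sum

/-- `f ≡_X g`: the same dimension, and the same signature at every `σ ∈ X`. -/
def FormEquiv {G : Type*} [CommGroup G] (X : Set (Character G)) (f g : List G) : Prop :=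
  f.length = g.length ∧ ∀ σ ∈ X, sgn σ f = sgn σ g

/-- `D_X(f)`: the elements `a` of `G` with `f ≡_X ⟨a⟩ ⊕ g` for some form `g`. -/
def represented {G : Type*} [CommGroup G] (X : Set (Character G)) (f : List G) : Set G :=
  {a | ∃ g : List G, FormEquiv X f (a :: g)}

/-- `(X, G)`, with distinguished element `e` (written `-1` in the literature), is an abstract
space of signatures of exponent `2 ^ n`.  In the last axiom forms have dimension at least one. -/
structure IsSpaceOfSignatures (n : ℕ) {G : Type*} [CommGroup G] (e : G)
    (X : Set (Character G)) : Prop where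
  exponent : ∀ g : G, g ^ 2 ^ n = 1
  odd_pow_mem : ∀ σ ∈ X, ∀ k : ℕ, Odd k → σ ^ k ∈ X
  isClosed : IsClosed X
  map_neg_one : ∀ σ ∈ X, ((σ e : Circle) : ℂ) = -1
  separating : ∀ g : G, (∀ σ ∈ X, σ g = 1) → g = 1
  represented_append : ∀ f g : List G, f ≠ [] → g ≠ [] →
    represented X (f ++ g) = ⋃ x ∈ represented X f, ⋃ y ∈ represented X g, represented X [x, y]

/-- `(X, G)` is an abstract space of orderings.  (In exponent `2` one has `σ ^ k = σ` for odd `k`,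
so the axiom on odd powers is void.) -/
def IsSpaceOfOrderings {G : Type*} [CommGroup G] (e : G) (X : Set (Character G)) : Prop :=
  IsSpaceOfSignatures 1 e X

/-- `(X, G)` is a fan: an abstract space of orderings such that `X` consists of all characters
of `G` with `σ(-1) = -1`. -/
def IsFan {G : Type*} [CommGroup G] (e : G) (X : Set (Character G)) : Prop :=
  IsSpaceOfOrderings e X ∧ X = {σ : Character G | ((σ e : Circle) : ℂ) = -1}

/-- `X` is (the underlying set of) a subspace of `(X', G')`: the set of all `σ ∈ X'` that are
trivial on some subgroup `Δ` of `G'`. -/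
def IsSubspace {G : Type*} [CommGroup G] (X' X : Set (Character G)) : Prop :=
  ∃ Δ : Subgroup G, X = {σ | σ ∈ X' ∧ ∀ d ∈ Δ, σ d = 1}

/-- `Y^⊥ = ⋂_{σ ∈ Y} ker σ`. -/
noncomputable def perp {G : Type*} [CommGroup G] (Y : Set (Character G)) : Subgroup G :=
  ⨅ σ ∈ Y, MonoidHom.ker σ

/-- A set `Y` of characters of `G`, as a set of characters of `G / Y^⊥`.  The group that belongs
to a subspace `Y` is `G / Y^⊥`. -/
def descend {G : Type*} [CommGroup G] (Y : Set (Character G)) : Set (Character (G ⧸ perp Y)) :=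
  {χ | χ.comp (QuotientGroup.mk' (perp Y)) ∈ Y}

/-- The subset `Y`, with its group `G / Y^⊥`, is a fan. -/
def IsFanSubset {G : Type*} [CommGroup G] (e : G) (Y : Set (Character G)) : Prop :=
  IsFan (QuotientGroup.mk' (perp Y) e) (descend Y)

/-- The fibre through `σ` of the canonical map `Λ : X → M` onto the set `M` of classes. -/
def fibre {G : Type*} [CommGroup G] {X : Set (Character G)} (s : Setoid X) (σ : X) :
    Set (Character G) :=
  {τ | ∃ h : τ ∈ X, Quotient.mk s ⟨τ, h⟩ = Quotient.mk s σ}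

/-- The equivalence relation `s` is a `P`-structure on `X`: each fibre is a fan, and
`{σ₀, σ₁, σ₂, σ₃}` meets at most two fibres whenever `σ₀σ₁σ₂σ₃ = 1`. -/
structure IsPStructure {G : Type*} [CommGroup G] (e : G) (X : Set (Character G))
    (s : Setoid X) : Prop where
  fibre_isFan : ∀ σ : X, IsFanSubset e (fibre s σ)
  meets_at_most_two : ∀ σ : Fin 4 → X, (∏ i, (σ i : Character G)) = 1 →
    (Set.range fun i => Quotient.mk s (σ i)).ncard ≤ 2

/-- `σ ∼ τ`: the product `στ` is the square of an element of `X'`. -/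
def Linked {G : Type*} [CommGroup G] (X' : Set (Character G)) (σ τ : Character G) : Prop :=
  ∃ ρ ∈ X', σ * τ = ρ ^ 2

/-- Whenever `σ₀σ₁σ₂σ₃ = 1` in `X`, the signature `σ₀` is linked to exactly one of
`σ₁, σ₂, σ₃`, or to all three of them. -/
def OneOrAllLinked {G : Type*} [CommGroup G] (X' X : Set (Character G)) : Prop :=
  ∀ σ₀ ∈ X, ∀ σ₁ ∈ X, ∀ σ₂ ∈ X, ∀ σ₃ ∈ X, σ₀ * σ₁ * σ₂ * σ₃ = 1 →
    ((Linked X' σ₀ σ₁ ∧ ¬ Linked X' σ₀ σ₂ ∧ ¬ Linked X' σ₀ σ₃) ∨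
      (¬ Linked X' σ₀ σ₁ ∧ Linked X' σ₀ σ₂ ∧ ¬ Linked X' σ₀ σ₃) ∨
      (¬ Linked X' σ₀ σ₁ ∧ ¬ Linked X' σ₀ σ₂ ∧ Linked X' σ₀ σ₃)) ∨
    (Linked X' σ₀ σ₁ ∧ Linked X' σ₀ σ₂ ∧ Linked X' σ₀ σ₃)

end SignatureSpaces

namespace SignatureSpaces

open Topology

/-! The heart is `IsSpaceOfSignatures.mul_mul_mem_of_linked`: for σ ∼ τ ∼ ω of exponent two, υ = στω
lies in `X'`. Given condition 2, the quadruple τ, σ, ω, υ then has τ linked to σ and ω, hence to υ,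
and τυ = σω; so ∼ is transitive and its classes are closed under triple products. Translated to the
identity, such a class is a closed group of characters, so by duality it is a fan
(`isFanSubset_of_mul_mul_mem`). Conversely, in a fan two links force the third; and if σ₀ had no
link, the other three would share one class, which would then contain their product σ₀.

By `IsSpaceOfSignatures.mem_of_ker`, the heart amounts to ker υ being closed under binary
representation. Write σ = τρ₁², ω = τρ₂² and let 1 + b = c + d. The serious obstruction is that
ρ₁(b), ρ₂(b) = ±i while ρ₁ and ρ₂ match c, d with 1, b in opposite ways.
`IsSpaceOfSignatures.false_of_pair` excludes it by splitting a ternary form, congruent to another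
where (1 - c)(1 - d) = 0 and made so everywhere by a factor vanishing elsewhere.

The quotient is Hausdorff because ∼ is closed: it is the preimage under multiplication of the
compact set of squares of `X'`. -/

theorem t2Space_quotient_of_isClosed {α : Type*} [TopologicalSpace α] [CompactSpace α] [T2Space α]
    (s : Setoid α) (hs : IsClosed {p : α × α | s p.1 p.2}) : T2Space (Quotient s) := by
  have hsat : ∀ C : Set α, IsClosed C → IsClosed {y | ∃ x ∈ C, s x y} := by
    intro C hC
    have h : {y | ∃ x ∈ C, s x y} =
        Prod.snd '' ((C ×ˢ Set.univ) ∩ {p : α × α | s p.1 p.2}) := by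
      ext y
      simp
    rw [h]
    exact (((hC.prod isClosed_univ).inter hs).isCompact.image continuous_snd).isClosed
  have hmk : IsClosedMap (Quotient.mk s) := by
    intro C hC
    have hq : IsQuotientMap (Quotient.mk s) := isQuotientMap_quotient_mk'
    rw [← hq.isClosed_preimage]
    convert hsat C hC using 1
    ext y
    simp only [Set.mem_preimage, Set.mem_image, Set.mem_ofPred_eq]
    exact exists_congr fun x => and_congr_right fun _ => Quotient.eq
  have hcont : Continuous (Quotient.mk s) := continuous_quotient_mk'
  refine ⟨fun a b hab => ?_⟩
  obtain ⟨x, rfl⟩ := Quotient.exists_rep a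
  obtain ⟨y, rfl⟩ := Quotient.exists_rep b
  have hcl : ∀ z, IsClosed (Quotient.mk s ⁻¹' {Quotient.mk s z}) := by
    intro z
    rw [← Set.image_singleton]
    exact (hmk _ isClosed_singleton).preimage hcont
  have hdisj : Disjoint (Quotient.mk s ⁻¹' {Quotient.mk s x}) (Quotient.mk s ⁻¹' {Quotient.mk s y}) :=
    Disjoint.preimage _ (Set.disjoint_singleton.2 hab)
  -- Classes are closed, so normality separates them; removing the closed images of the complements
  -- leaves open sets of whole classes.
  obtain ⟨U, V, hU, hV, hxU, hyV, hUV⟩ := normal_separation (hcl x) (hcl y) hdisj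
  refine ⟨(Quotient.mk s '' Uᶜ)ᶜ, (Quotient.mk s '' Vᶜ)ᶜ, (hmk _ hU.isClosed_compl).isOpen_compl,
    (hmk _ hV.isClosed_compl).isOpen_compl, ?_, ?_, ?_⟩
  · rintro ⟨z, hz, hzx⟩
    exact hz (hxU hzx)
  · rintro ⟨z, hz, hzy⟩
    exact hz (hyV hzy)
  · rw [Set.disjoint_left]
    intro c hcU hcV
    obtain ⟨z, rfl⟩ := Quotient.exists_rep c
    have hzU : z ∈ U := by
      by_contra h
      exact hcU ⟨z, h, rfl⟩
    have hzV : z ∈ V := by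
      by_contra h
      exact hcV ⟨z, h, rfl⟩
    exact Set.disjoint_left.1 hUV hzU hzV

/-! ### The compact group of characters -/

section CharacterGroup

variable {G : Type*} [CommGroup G]

theorem isEmbedding_coe_character : IsEmbedding (fun (σ : Character G) (g : G) => σ g) :=
  ⟨⟨rfl⟩, DFunLike.coe_injective⟩

/-- Multiplicativity is a closed condition in the compact product of circles; this is the source of
compactness. -/
theorem isClosedEmbedding_coe_character :
    IsClosedEmbedding (fun (σ : Character G) (g : G) => σ g) := by
  refine ⟨isEmbedding_coe_character, ?_⟩
  have h : Set.range (fun (σ : Character G) (g : G) => σ g) =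
      ⋂ a : G, ⋂ b : G, {f : G → Circle | f (a * b) = f a * f b} := by
    ext f
    simp only [Set.mem_range, Set.mem_iInter, Set.mem_ofPred_eq]
    constructor
    · rintro ⟨σ, rfl⟩ a b
      exact map_mul σ a b
    · intro hf
      exact ⟨MonoidHom.mk' f hf, rfl⟩
  rw [h]
  exact isClosed_iInter fun a => isClosed_iInter fun b =>
    isClosed_eq (by fun_prop) (by fun_prop)

instance : T2Space (Character G) := isEmbedding_coe_character.t2Space

instance : CompactSpace (Character G) := isClosedEmbedding_coe_character.compactSpace

theorem continuous_eval_character (g : G) : Continuous fun σ : Character G => σ g :=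
  (continuous_apply g).comp isEmbedding_coe_character.continuous

instance : ContinuousMul (Character G) where
  continuous_mul := by
    rw [isEmbedding_coe_character.continuous_iff]
    exact continuous_pi fun g =>
      ((continuous_eval_character g).comp continuous_fst).mul
        ((continuous_eval_character g).comp continuous_snd)

theorem isClosed_setOf_eval_eq (g : G) (z : Circle) : IsClosed {σ : Character G | σ g = z} :=
  isClosed_eq (continuous_eval_character g) continuous_const

/-- A closed set of characters contains every character that it approximates on finite sets. -/
theorem mem_of_forall_finset_agree {Y : Set (Character G)} (hY : IsClosed Y) {υ : Character G}
    (h : ∀ F : Finset G, ∃ τ ∈ Y, ∀ a ∈ F, τ a = υ a) : υ ∈ Y := by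
  by_contra hυ
  have hempty : (Y ∩ ⋂ a : G, {σ : Character G | σ a = υ a}) = ∅ := by
    rw [Set.eq_empty_iff_forall_notMem]
    rintro τ ⟨hτ, hτυ⟩
    rw [Set.mem_iInter] at hτυ
    exact hυ ((MonoidHom.ext hτυ : τ = υ) ▸ hτ)
  obtain ⟨F, hF⟩ := hY.isCompact.elim_finite_subfamily_closed _
    (fun a => isClosed_setOf_eval_eq a (υ a)) hempty
  obtain ⟨τ, hτ, hτF⟩ := h F
  have : τ ∈ Y ∩ ⋂ a ∈ F, {σ : Character G | σ a = υ a} :=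
    ⟨hτ, Set.mem_iInter₂.2 hτF⟩
  rw [hF] at this
  exact this

end CharacterGroup

/-! ### Closedness of the linking relation -/

section Linked

variable {G : Type*} [CommGroup G]

theorem isClosed_setOf_linked {X' : Set (Character G)} (hX' : IsClosed X') :
    IsClosed {p : Character G × Character G | Linked X' p.1 p.2} := by
  have hsq : IsClosed ((fun ρ : Character G => ρ ^ 2) '' X') :=
    (hX'.isCompact.image (continuous_pow 2)).isClosed
  have h : {p : Character G × Character G | Linked X' p.1 p.2} =
      (fun p => p.1 * p.2) ⁻¹' ((fun ρ : Character G => ρ ^ 2) '' X') := by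
    ext p
    simp [Linked, eq_comm]
  rw [h]
  exact hsq.preimage continuous_mul

theorem IsSubspace.isClosed {X' X : Set (Character G)} (hX' : IsClosed X')
    (hX : IsSubspace X' X) : IsClosed X := by
  obtain ⟨Δ, rfl⟩ := hX
  have h : {σ : Character G | σ ∈ X' ∧ ∀ d ∈ Δ, σ d = 1} =
      X' ∩ ⋂ d ∈ Δ, {σ : Character G | σ d = 1} := by
    ext σ
    simp
  rw [h]
  exact hX'.inter (isClosed_biInter fun d _ => isClosed_setOf_eval_eq d 1)

theorem IsSubspace.t2Space_quotient {X' X : Set (Character G)} (hX' : IsClosed X')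
    (hX : IsSubspace X' X) (s : Setoid X) (hs : ∀ σ τ : X, s σ τ ↔ Linked X' σ τ) :
    T2Space (Quotient s) := by
  have : CompactSpace X := isCompact_iff_compactSpace.1 (hX.isClosed hX').isCompact
  apply t2Space_quotient_of_isClosed
  have h : {p : X × X | s p.1 p.2} = (fun p : X × X => ((p.1 : Character G), (p.2 : Character G))) ⁻¹'
      {p : Character G × Character G | Linked X' p.1 p.2} := by
    ext p
    exact hs p.1 p.2
  rw [h]
  exact (isClosed_setOf_linked hX').preimage
    ((continuous_subtype_val.comp continuous_fst).prodMk
      (continuous_subtype_val.comp continuous_snd))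

end Linked

/-! ### Forms and their signatures -/

section Forms

variable {G : Type*} [CommGroup G]

@[simp]
theorem sgn_nil (σ : Character G) : sgn σ [] = 0 := rfl

@[simp]
theorem sgn_cons (σ : Character G) (a : G) (f : List G) :
    sgn σ (a :: f) = ((σ a : Circle) : ℂ) + sgn σ f := by
  simp [sgn]

@[simp]
theorem sgn_append (σ : Character G) (f g : List G) : sgn σ (f ++ g) = sgn σ f + sgn σ g := by
  simp [sgn]

@[simp]
theorem sgn_replicate (σ : Character G) (m : ℕ) (a : G) :
    sgn σ (List.replicate m a) = m * ((σ a : Circle) : ℂ) := by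
  simp [sgn]

theorem sgn_perm (σ : Character G) {f g : List G} (h : f.Perm g) : sgn σ f = sgn σ g :=
  (h.map _).sum_eq

@[simp]
theorem sgn_map_mul (σ : Character G) (a : G) (f : List G) :
    sgn σ (f.map (a * ·)) = ((σ a : Circle) : ℂ) * sgn σ f := by
  induction f with
  | nil => simp
  | cons b f ih => simp [ih, mul_add]

/-- The tensor product of two forms. -/
def tensor (f g : List G) : List G := f.flatMap fun a => g.map (a * ·)

@[simp]
theorem tensor_nil_left (g : List G) : tensor [] g = [] := rfl

theorem tensor_cons_left (a : G) (f g : List G) :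
    tensor (a :: f) g = g.map (a * ·) ++ tensor f g := by
  simp [tensor]

@[simp]
theorem sgn_tensor (σ : Character G) (f g : List G) :
    sgn σ (tensor f g) = sgn σ f * sgn σ g := by
  induction f with
  | nil => simp
  | cons a f ih => simp [tensor_cons_left, ih, add_mul]

@[simp]
theorem length_tensor (f g : List G) : (tensor f g).length = f.length * g.length := by
  induction f with
  | nil => simp
  | cons a f ih => simp [tensor_cons_left, ih, add_mul, add_comm]

theorem mem_tensor {f g : List G} {x : G} :
    x ∈ tensor f g ↔ ∃ a ∈ f, ∃ b ∈ g, a * b = x := by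
  simp [tensor]

/-- The form `⟨1, a, a², …, a^(N-1)⟩`. -/
def powers (a : G) (N : ℕ) : List G := (List.range N).map (a ^ ·)

@[simp]
theorem length_powers (a : G) (N : ℕ) : (powers a N).length = N := by simp [powers]

theorem powers_succ (a : G) (N : ℕ) : powers a (N + 1) = 1 :: (powers a N).map (a * ·) := by
  simp [powers, List.range_succ_eq_map, pow_succ']

theorem sgn_powers (σ : Character G) (a : G) (N : ℕ) :
    sgn σ (powers a N) = ∑ i ∈ Finset.range N, ((σ a : Circle) : ℂ) ^ i := by
  induction N with
  | zero => simp [powers]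
  | succ N ih => rw [powers_succ, sgn_cons, sgn_map_mul, ih, Finset.sum_range_succ', Finset.mul_sum,
      add_comm]; simp [pow_succ']

/-- A geometric sum over a nontrivial root of unity vanishes, so multiplying by this form confines a
congruence to the set where σ(a) = 1. -/
theorem sgn_powers_of_ne_one {σ : Character G} {a : G} {N : ℕ} (ha : a ^ N = 1) (h : σ a ≠ 1) :
    sgn σ (powers a N) = 0 := by
  rw [sgn_powers]
  have h1 : ((σ a : Circle) : ℂ) - 1 ≠ 0 := by
    rw [sub_ne_zero]
    exact fun h' => h (Circle.ext (by simpa using h'))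
  apply mul_right_cancel₀ h1
  rw [geom_sum_mul, zero_mul, ← Circle.coe_pow, ← map_pow, ha]
  simp

theorem eq_of_mem_powers {σ : Character G} {a : G} {N : ℕ} (h : σ a = 1) {x : G}
    (hx : x ∈ powers a N) : σ x = 1 := by
  simp only [powers, List.mem_map] at hx
  obtain ⟨i, -, rfl⟩ := hx
  rw [map_pow, h, one_pow]

/-- Two sums of two complex numbers of modulus one agree only if they vanish or have the same
summands. -/
theorem circle_add_eq_add {a b c d : Circle} (h : (a : ℂ) + b = c + d) :
    (a : ℂ) + b = 0 ∨ (c = a ∧ d = b) ∨ (c = b ∧ d = a) := by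
  by_cases h0 : (a : ℂ) + b = 0
  · exact Or.inl h0
  right
  -- Conjugation inverts unit complex numbers, so a nonzero sum also determines the product, hence
  -- the unordered pair.
  have hc : (starRingEnd ℂ) ((a : ℂ) + b) = (starRingEnd ℂ) ((c : ℂ) + d) := by rw [h]
  simp only [map_add, ← Circle.coe_inv_eq_conj, Circle.coe_inv] at hc
  have ha := a.coe_ne_zero
  have hb := b.coe_ne_zero
  have hc' := c.coe_ne_zero
  have hd := d.coe_ne_zero
  field_simp at hc
  have hprod : (c : ℂ) * d = a * b := by
    apply mul_left_cancel₀ h0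
    linear_combination hc - (a : ℂ) * b * h
  have hroot : ((c : ℂ) - a) * (c - b) = 0 := by linear_combination -(c : ℂ) * h - hprod
  rcases mul_eq_zero.1 hroot with h1 | h1
  · have hca := sub_eq_zero.1 h1
    refine Or.inl ⟨Circle.ext hca, Circle.ext ?_⟩
    linear_combination -h - hca
  · have hcb := sub_eq_zero.1 h1
    refine Or.inr ⟨Circle.ext hcb, Circle.ext ?_⟩
    linear_combination -h - hcb

theorem norm_sgn_le (σ : Character G) (f : List G) : ‖sgn σ f‖ ≤ f.length := by
  induction f with
  | nil => simp
  | cons a f ih =>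
    rw [sgn_cons]
    refine (norm_add_le _ _).trans ?_
    rw [Circle.norm_coe, List.length_cons, Nat.cast_succ]
    linarith

/-- This is the equality case of the triangle inequality; rotating by z⁻¹ reduces it to a real part
equal to 1. -/
theorem eq_of_add_sgn_eq {σ : Character G} {x : G} {f : List G} {z : Circle}
    (h : ((σ x : Circle) : ℂ) + sgn σ f = (f.length + 1) * z) : σ x = z := by
  have h1 : ‖((f.length : ℂ) + 1) * z - ((σ x : Circle) : ℂ)‖ ≤ f.length := by
    rw [← h, add_sub_cancel_left]
    exact norm_sgn_le σ f
  set w : Circle := z⁻¹ * σ x with hw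
  have h2 : ‖((f.length : ℂ) + 1) - (w : ℂ)‖ ≤ f.length := by
    have : ((f.length : ℂ) + 1) * z - ((σ x : Circle) : ℂ) = z * (((f.length : ℂ) + 1) - w) := by
      rw [hw, Circle.coe_mul, Circle.coe_inv, mul_sub, mul_inv_cancel_left₀ z.coe_ne_zero, mul_comm]
    rwa [this, norm_mul, Circle.norm_coe, one_mul] at h1
  have h3 : (f.length : ℝ) + 1 - (w : ℂ).re ≤ f.length := by
    refine le_trans ?_ h2
    simpa using Complex.re_le_norm (((f.length : ℂ) + 1) - (w : ℂ))
  have h4 : Complex.normSq (w : ℂ) = 1 := Circle.normSq_coe w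
  rw [Complex.normSq_apply] at h4
  have hre : (w : ℂ).re = 1 := by nlinarith [mul_self_nonneg (w : ℂ).im]
  have him : (w : ℂ).im = 0 := by
    rw [hre] at h4
    nlinarith
  have h5 : w = 1 := Circle.ext (Complex.ext (by simpa using hre) (by simpa using him))
  rw [hw, inv_mul_eq_one] at h5
  exact h5.symm

variable {X : Set (Character G)}

theorem sgn_eq_of_forall {σ : Character G} {f : List G} {z : Circle} (hf : ∀ a ∈ f, σ a = z) :
    sgn σ f = f.length * z := by
  induction f with
  | nil => simp
  | cons a f ih =>
    rw [sgn_cons, ih fun b hb => hf b (List.mem_cons_of_mem _ hb), hf a List.mem_cons_self,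
      List.length_cons]
    push_cast
    ring

/-- If `σ` is constant on the entries of a form, it has the same value on the elements that the
form represents. -/
theorem eq_of_mem_represented {σ : Character G} (hσ : σ ∈ X) {f : List G} {z : Circle}
    (hf : ∀ a ∈ f, σ a = z) {x : G} (hx : x ∈ represented X f) : σ x = z := by
  obtain ⟨g, hlen, hg⟩ := hx
  have h := hg σ hσ
  rw [sgn_eq_of_forall hf, sgn_cons, hlen, List.length_cons] at h
  push_cast at h
  exact eq_of_add_sgn_eq h.symm

theorem mem_represented_pair {a b c : G} :
    c ∈ represented X [a, b] ↔ ∃ d, FormEquiv X [a, b] [c, d] := by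
  constructor
  · rintro ⟨g, hlen, hg⟩
    obtain ⟨d, rfl⟩ := List.length_eq_one_iff.1 (by simpa using hlen.symm : g.length = 1)
    exact ⟨d, hlen, hg⟩
  · rintro ⟨d, hd⟩
    exact ⟨[d], hd⟩

theorem FormEquiv.pair_values {a b c d : G} (h : FormEquiv X [a, b] [c, d]) {σ : Character G}
    (hσ : σ ∈ X) : ((σ a : Circle) : ℂ) + σ b = 0 ∨ (σ c = σ a ∧ σ d = σ b) ∨
      (σ c = σ b ∧ σ d = σ a) :=
  circle_add_eq_add (by simpa using h.2 σ hσ)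

theorem represented_pair_values {a b c : G} (h : c ∈ represented X [a, b]) {σ : Character G}
    (hσ : σ ∈ X) : ((σ a : Circle) : ℂ) + σ b = 0 ∨ σ c = σ a ∨ σ c = σ b := by
  obtain ⟨d, hd⟩ := mem_represented_pair.1 h
  rcases hd.pair_values hσ with h | h | h
  exacts [Or.inl h, Or.inr (Or.inl h.1), Or.inr (Or.inr h.1)]

end Forms

/-! ### Products of the forms of powers -/

section Pfister

variable {G : Type*} [CommGroup G]

/-- The product of the forms `⟨1, a, …, a^(N-1)⟩` for `a` in a list. -/
def pfister (N : ℕ) (l : List G) : List G := l.foldr (fun a f => tensor (powers a N) f) [1]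

theorem pfister_cons (N : ℕ) (a : G) (l : List G) :
    pfister N (a :: l) = tensor (powers a N) (pfister N l) := rfl

@[simp]
theorem length_pfister (N : ℕ) (l : List G) : (pfister N l).length = N ^ l.length := by
  induction l with
  | nil => simp [pfister]
  | cons a l ih => rw [pfister_cons, length_tensor, ih, length_powers, List.length_cons, pow_succ']

theorem sgn_pfister_eq_zero {N : ℕ} (hG : ∀ g : G, g ^ N = 1) {σ : Character G} {l : List G}
    (h : ∃ a ∈ l, σ a ≠ 1) : sgn σ (pfister N l) = 0 := by
  induction l with
  | nil => simp at h
  | cons b l ih =>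
    rw [pfister_cons, sgn_tensor]
    by_cases hb : σ b = 1
    · rw [ih, mul_zero]
      obtain ⟨a, ha, hσ⟩ := h
      rcases List.mem_cons.1 ha with rfl | ha
      · exact absurd hb hσ
      · exact ⟨a, ha, hσ⟩
    · rw [sgn_powers_of_ne_one (hG b) hb, zero_mul]

theorem eq_one_of_mem_pfister {N : ℕ} {σ : Character G} {l : List G} (h : ∀ a ∈ l, σ a = 1)
    {x : G} (hx : x ∈ pfister N l) : σ x = 1 := by
  induction l generalizing x with
  | nil => simp [pfister] at hx; simp [hx]
  | cons b l ih =>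
    rw [pfister_cons, mem_tensor] at hx
    obtain ⟨a, ha, c, hc, rfl⟩ := hx
    rw [map_mul, eq_of_mem_powers (h b List.mem_cons_self) ha,
      ih (fun a ha => h a (List.mem_cons_of_mem _ ha)) hc, mul_one]

end Pfister

/-! ### A membership criterion for characters of exponent two -/

section Membership

variable {G : Type*} [CommGroup G] {n : ℕ} {e : G} {X : Set (Character G)}

theorem IsSpaceOfSignatures.represented_singleton (hX : IsSpaceOfSignatures n e X) {a x : G}
    (hx : x ∈ represented X [a]) : x = a := by
  refine (inv_mul_eq_one.1 (hX.separating (a⁻¹ * x) fun σ hσ => ?_)).symm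
  rw [map_mul, map_inv, eq_of_mem_represented hσ (z := σ a) (by simp) hx, inv_mul_cancel]

theorem IsSpaceOfSignatures.represented_cons (hX : IsSpaceOfSignatures n e X) {a x : G}
    {f : List G} (hf : f ≠ []) (hx : x ∈ represented X (a :: f)) :
    ∃ y ∈ represented X f, x ∈ represented X [a, y] := by
  have h := hX.represented_append [a] f (by simp) hf
  rw [List.singleton_append] at h
  rw [h] at hx
  simp only [Set.mem_iUnion, exists_prop] at hx
  obtain ⟨z, hz, y, hy, hxy⟩ := hx
  rw [hX.represented_singleton hz] at hxy
  exact ⟨y, hy, hxy⟩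

/-- The representation axiom peels off one entry at a time, so closure under binary forms propagates
to all forms. -/
theorem IsSpaceOfSignatures.represented_ker (hX : IsSpaceOfSignatures n e X) {υ : Character G}
    (h : ∀ a b c : G, υ a = 1 → υ b = 1 → c ∈ represented X [a, b] → υ c = 1)
    {f : List G} (hf : f ≠ []) (hfυ : ∀ a ∈ f, υ a = 1) {x : G} (hx : x ∈ represented X f) :
    υ x = 1 := by
  induction f generalizing x with
  | nil => exact absurd rfl hf
  | cons a f ih =>
    by_cases hf' : f = []
    · subst hf'
      rw [hX.represented_singleton hx]
      exact hfυ a List.mem_cons_self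
    · obtain ⟨y, hy, hxy⟩ := hX.represented_cons hf' hx
      exact h a y x (hfυ a List.mem_cons_self)
        (ih hf' (fun b hb => hfυ b (List.mem_cons_of_mem _ hb)) hy) hxy

/-- Such a form is congruent to m + 1 copies of ⟨1, -1⟩. -/
theorem mem_represented_of_sgn_eq_zero (he : ∀ σ ∈ X, ((σ e : Circle) : ℂ) = -1) {f : List G}
    {m : ℕ} (hlen : f.length = 2 * (m + 1)) (hf : ∀ σ ∈ X, sgn σ f = 0) :
    e ∈ represented X f := by
  refine ⟨List.replicate m e ++ List.replicate (m + 1) 1, ?_, fun σ hσ => ?_⟩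
  · simp [hlen]
    ring
  · simp [hf σ hσ, he σ hσ]

theorem eq_neg_one_of_sq {z : Circle} (h : z ^ 2 = 1) (h1 : z ≠ 1) : (z : ℂ) = -1 := by
  have h2 : ((z : ℂ)) ^ 2 = 1 := by rw [← Circle.coe_pow, h, Circle.coe_one]
  rcases (by simpa using h2 : (z : ℂ) = 1 ∨ (z : ℂ) = -1) with h | h
  · exact absurd (Circle.ext (by simpa using h)) h1
  · exact h

/-- A character of exponent two belongs to a space of signatures as soon as its kernel is closed
under the representation of elements by binary forms. -/
theorem IsSpaceOfSignatures.mem_of_ker (hn : 1 ≤ n) (hX : IsSpaceOfSignatures n e X)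
    {υ : Character G} (hυ : υ ^ 2 = 1) (hυe : ((υ e : Circle) : ℂ) = -1)
    (h : ∀ a b c : G, υ a = 1 → υ b = 1 → c ∈ represented X [a, b] → υ c = 1) : υ ∈ X := by
  have hval : ∀ g : G, υ g = 1 ∨ ((υ g : Circle) : ℂ) = -1 := by
    intro g
    by_cases hg : υ g = 1
    · exact Or.inl hg
    · exact Or.inr (eq_neg_one_of_sq (DFunLike.congr_fun hυ g) hg)
  -- Otherwise compactness gives finitely many elements of ker υ not all killed by any σ in `X`.
  -- Their Pfister product has signature zero, so it represents `e`, although all its entries lie in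
  -- ker υ.
  obtain ⟨χ, hχ, hχυ⟩ : ∃ χ ∈ X, ∀ a : G, υ a = 1 → χ a = 1 := by
    by_contra hno
    have hempty : (X ∩ ⋂ a : υ.ker, {σ : Character G | σ (a : G) = 1}) = ∅ := by
      rw [Set.eq_empty_iff_forall_notMem]
      rintro χ ⟨hχ, hχυ⟩
      rw [Set.mem_iInter] at hχυ
      exact hno ⟨χ, hχ, fun a ha => hχυ ⟨a, ha⟩⟩
    obtain ⟨F, hF⟩ := hX.isClosed.isCompact.elim_finite_subfamily_closed _
      (fun a : υ.ker => isClosed_setOf_eval_eq (a : G) 1) hempty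
    -- The extra 1 imposes no condition, but makes the dimension even when `F` is empty.
    set l : List G := 1 :: F.toList.map Subtype.val with hl
    have hlυ : ∀ a ∈ l, υ a = 1 := by
      intro a ha
      rcases List.mem_cons.1 ha with rfl | ha
      · exact map_one υ
      · obtain ⟨b, -, rfl⟩ := List.mem_map.1 ha
        exact b.2
    have hzero : ∀ σ ∈ X, sgn σ (pfister (2 ^ n) l) = 0 := by
      intro σ hσ
      apply sgn_pfister_eq_zero hX.exponent
      by_contra hall
      push Not at hall
      have : σ ∈ X ∩ ⋂ a ∈ F, {σ : Character G | σ (a : G) = 1} :=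
        ⟨hσ, Set.mem_iInter₂.2 fun a ha => hall a
          (List.mem_cons_of_mem _ (List.mem_map_of_mem (Finset.mem_toList.2 ha)))⟩
      rw [hF] at this
      exact this
    obtain ⟨m, hm⟩ : ∃ m, (pfister (2 ^ n) l).length = 2 * (m + 1) := by
      rw [length_pfister, hl, List.length_cons, pow_succ']
      obtain ⟨k, rfl⟩ := Nat.exists_eq_add_of_le' hn
      refine ⟨2 ^ k * (2 ^ (k + 1)) ^ (F.toList.map Subtype.val).length - 1, ?_⟩
      rw [Nat.sub_add_cancel (Nat.one_le_iff_ne_zero.2 (by positivity)), pow_succ']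
      ring
    have hne : pfister (2 ^ n) l ≠ [] := by
      intro h0
      rw [h0] at hm
      simp at hm
    have := hX.represented_ker h hne (fun a ha => eq_one_of_mem_pfister hlυ ha)
      (mem_represented_of_sgn_eq_zero hX.map_neg_one hm hzero)
    rw [this] at hυe
    norm_num at hυe
  have : υ = χ := by
    ext g
    rcases hval g with hg | hg
    · rw [hg, hχυ g hg]
    · have h1 : υ (g * e) = 1 := Circle.ext (by simp [hg, hυe])
      have h2 := congrArg (fun z : Circle => (z : ℂ)) (hχυ _ h1)
      simp only [map_mul, Circle.coe_mul, hX.map_neg_one χ hχ, Circle.coe_one] at h2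
      rw [hg]
      linear_combination h2
  rw [this]
  exact hχ

theorem FormEquiv.mul_pair {a b c d : G} (h : FormEquiv X [a, b] [c, d]) (g : G) :
    FormEquiv X [g * a, g * b] [g * c, g * d] := by
  refine ⟨rfl, fun σ hσ => ?_⟩
  have := h.2 σ hσ
  simp only [sgn_cons, sgn_nil, map_mul, Circle.coe_mul] at this ⊢
  linear_combination ((σ g : Circle) : ℂ) * this

theorem FormEquiv.swap {a b c d : G} (h : FormEquiv X [a, b] [c, d]) :
    FormEquiv X [a, b] [d, c] := by
  refine ⟨rfl, fun σ hσ => ?_⟩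
  have := h.2 σ hσ
  simp only [sgn_cons, sgn_nil] at this ⊢
  linear_combination this

end Membership

/-! ### Excluding crossed matchings -/

section Linkage

variable {G : Type*} [CommGroup G] {n : ℕ} {e : G} {X : Set (Character G)}

theorem eq_of_mem_represented_mul_powers {χ : Character G} (hχ : χ ∈ X)
    {δ g x : G} {N : ℕ} (hδ : χ δ = 1) (hx : x ∈ represented X ((powers δ N).map (g * ·))) :
    χ x = χ g := by
  refine eq_of_mem_represented hχ (fun a ha => ?_) hx
  obtain ⟨y, hy, rfl⟩ := List.mem_map.1 ha
  rw [map_mul, eq_of_mem_powers hδ hy, mul_one]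

/-- On the set where `(1 - c)(1 - d) = 0` the form `⟨1, -d, c²d²⟩` represents `cd²`. The elements
`x`, `w₁` and `w₂` agree there with the entries of this form. -/
theorem IsSpaceOfSignatures.exists_binary_representations (hX : IsSpaceOfSignatures n e X)
    {b c d : G} (h : FormEquiv X [1, b] [c, d]) :
    ∃ x w w₁ w₂ : G, c * d ^ 2 ∈ represented X [x, w] ∧ w ∈ represented X [w₁, w₂] ∧
      ∀ χ ∈ X, χ b = χ c * χ d →
        χ x = 1 ∧ χ w₁ = χ (e * d) ∧ χ w₂ = χ (c ^ 2 * d ^ 2) := by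
  -- Where χ(δ) = 1, the relation 1 + b = c + d becomes (1 - c)(1 - d) = 0; elsewhere `φ` has
  -- signature zero.
  set δ : G := b * (c * d)⁻¹ with hδ
  set φ : List G := powers δ (2 ^ n) with hφ
  have hN : ∃ k, 2 ^ n = k + 1 := Nat.exists_eq_succ_of_ne_zero (by positivity)
  obtain ⟨k, hk⟩ := hN
  have hφ1 : φ = 1 :: (powers δ k).map (δ * ·) := by rw [hφ, hk, powers_succ]
  have hφne : ∀ g : G, φ.map (g * ·) ≠ [] := by
    intro g
    simp [hφ1]
  have hequiv : FormEquiv X (tensor [1, e * d, c ^ 2 * d ^ 2] φ)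
      (tensor [c * d ^ 2, c ^ 2, e * (c * d)] φ) := by
    refine ⟨by simp, fun χ hχ => ?_⟩
    rw [sgn_tensor, sgn_tensor]
    by_cases h1 : χ δ = 1
    · congr 1
      have hb : χ b = χ c * χ d := by
        rw [hδ, map_mul, map_inv, mul_inv_eq_one, map_mul] at h1
        exact h1
      have hbC : ((χ b : Circle) : ℂ) = χ c * χ d := by rw [hb, Circle.coe_mul]
      have hs := h.2 χ hχ
      simp only [sgn_cons, sgn_nil, map_one, Circle.coe_one, hbC] at hs
      simp only [sgn_cons, sgn_nil, map_mul, map_pow, map_one, Circle.coe_mul, Circle.coe_pow,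
        Circle.coe_one, hX.map_neg_one χ hχ]
      have h0 : (1 - ((χ c : Circle) : ℂ)) * (1 - χ d) = 0 := by linear_combination hs
      rcases mul_eq_zero.1 h0 with h | h
      · rw [← sub_eq_zero.1 h]
        ring
      · rw [← sub_eq_zero.1 h]
        ring
    · rw [sgn_powers_of_ne_one (hX.exponent δ) h1, mul_zero, mul_zero]
  have hmem : c * d ^ 2 ∈ represented X
      (φ.map ((1 : G) * ·) ++ (φ.map ((e * d) * ·) ++ φ.map ((c ^ 2 * d ^ 2) * ·))) := by
    rw [tensor_cons_left, tensor_cons_left, tensor_cons_left, tensor_nil_left, List.append_nil,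
      tensor_cons_left] at hequiv
    -- The first φ on the right begins with 1, so its multiple by cd² exposes cd² as the leading
    -- entry.
    nth_rw 4 [hφ1] at hequiv
    rw [List.map_cons, mul_one, List.cons_append] at hequiv
    exact ⟨_, hequiv⟩
  rw [hX.represented_append _ _ (hφne _) (by simp [hφ1])] at hmem
  simp only [Set.mem_iUnion, exists_prop] at hmem
  obtain ⟨x, hx, w, hw, hxw⟩ := hmem
  rw [hX.represented_append _ _ (hφne _) (hφne _)] at hw
  simp only [Set.mem_iUnion, exists_prop] at hw
  obtain ⟨w₁, hw₁, w₂, hw₂, hw⟩ := hw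
  refine ⟨x, w, w₁, w₂, hxw, hw, fun χ hχ hb => ?_⟩
  have h1 : χ δ = 1 := by rw [hδ, map_mul, map_inv, mul_inv_eq_one, map_mul, hb]
  refine ⟨?_, eq_of_mem_represented_mul_powers hχ h1 hw₁,
    eq_of_mem_represented_mul_powers hχ h1 hw₂⟩
  rw [eq_of_mem_represented_mul_powers hχ h1 hx, map_one]

/-- The intermediate element w has value 1 at σ and -1 at ω and ρ₂. Hence τ(w) = -1 and ρ₁(w)² = -1,
whereas the representation of cd² by ⟨x, w⟩, read at ρ₁, forces ρ₁(w) = -1. -/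
theorem IsSpaceOfSignatures.false_of_pair (hX : IsSpaceOfSignatures n e X)
    {σ τ ω ρ₁ ρ₂ : Character G} (hσ : σ ∈ X) (hω : ω ∈ X) (hρ₁ : ρ₁ ∈ X)
    (hρ₂ : ρ₂ ∈ X) (hσρ : ∀ g, σ g = τ g * ρ₁ g ^ 2) (hωρ : ∀ g, ω g = τ g * ρ₂ g ^ 2)
    {b c d : G} (h : FormEquiv X [1, b] [c, d]) (hτc : τ c = 1) (hτd : τ d = 1)
    (h1c : ρ₁ c = 1) (h1d : ((ρ₁ d : Circle) : ℂ) ^ 2 = -1)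
    (h2c : ((ρ₂ c : Circle) : ℂ) ^ 2 = -1) (h2d : ρ₂ d = 1) : False := by
  have hσC : ∀ g, ((σ g : Circle) : ℂ) = τ g * ρ₁ g ^ 2 := fun g => by rw [hσρ]; simp
  have hωC : ∀ g, ((ω g : Circle) : ℂ) = τ g * ρ₂ g ^ 2 := fun g => by rw [hωρ]; simp
  have hσc : ((σ c : Circle) : ℂ) = 1 := by simp [hσC, hτc, h1c]
  have hσd : ((σ d : Circle) : ℂ) = -1 := by simp [hσC, hτd, h1d]
  have hωc : ((ω c : Circle) : ℂ) = -1 := by simp [hωC, hτc, h2c]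
  have hωd : ((ω d : Circle) : ℂ) = 1 := by simp [hωC, hτd, h2d]
  have hb : ∀ χ ∈ X, (((χ c : Circle) : ℂ) = 1 ∨ ((χ d : Circle) : ℂ) = 1) →
      χ b = χ c * χ d := by
    intro χ hχ hcd
    have hs := h.2 χ hχ
    simp only [sgn_cons, sgn_nil, map_one, Circle.coe_one] at hs
    apply Circle.ext
    rw [Circle.coe_mul]
    rcases hcd with h | h
    · rw [h] at hs ⊢
      linear_combination hs
    · rw [h] at hs ⊢
      linear_combination hs
  obtain ⟨x, w, w₁, w₂, ht, hw, hval⟩ := hX.exists_binary_representations h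
  have hvalC : ∀ χ ∈ X, (((χ c : Circle) : ℂ) = 1 ∨ ((χ d : Circle) : ℂ) = 1) →
      ((χ x : Circle) : ℂ) = 1 ∧ ((χ w₁ : Circle) : ℂ) = -χ d ∧
        ((χ w₂ : Circle) : ℂ) = (χ c : ℂ) ^ 2 * (χ d : ℂ) ^ 2 := by
    intro χ hχ hcd
    obtain ⟨h1, h2, h3⟩ := hval χ hχ (hb χ hχ hcd)
    rw [h1, h2, h3]
    simp [hX.map_neg_one χ hχ]
  have pair : ∀ {t a b : G}, t ∈ represented X [a, b] → ∀ χ ∈ X,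
      ((χ a : Circle) : ℂ) + χ b = 0 ∨ ((χ t : Circle) : ℂ) = χ a ∨ ((χ t : Circle) : ℂ) = χ b := by
    intro t a b ht χ hχ
    rcases represented_pair_values ht hχ with h | h | h
    exacts [Or.inl h, Or.inr (Or.inl (by rw [h])), Or.inr (Or.inr (by rw [h]))]
  have h1c' : ((ρ₁ c : Circle) : ℂ) = 1 := by simp [h1c]
  have h2d' : ((ρ₂ d : Circle) : ℂ) = 1 := by simp [h2d]
  obtain ⟨-, hσ1, hσ2⟩ := hvalC σ hσ (Or.inl hσc)
  obtain ⟨hωx, -, -⟩ := hvalC ω hω (Or.inr hωd)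
  obtain ⟨h1x, -, -⟩ := hvalC ρ₁ hρ₁ (Or.inl h1c')
  obtain ⟨-, h21, h22⟩ := hvalC ρ₂ hρ₂ (Or.inr h2d')
  have hwσ : ((σ w : Circle) : ℂ) = 1 := by
    have := pair hw σ hσ
    rw [hσ1, hσ2, hσc, hσd] at this
    norm_num at this
    exact this
  have hw2 : ((ρ₂ w : Circle) : ℂ) = -1 := by
    have := pair hw ρ₂ hρ₂
    rw [h21, h22, h2c, h2d'] at this
    norm_num at this
    exact this
  have hwω : ((ω w : Circle) : ℂ) = -1 := by
    have := pair ht ω hω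
    rw [map_mul, map_pow, Circle.coe_mul, Circle.coe_pow, hωx, hωc, hωd] at this
    norm_num at this
    rcases this with h | h
    · linear_combination h
    · exact h.symm
  have ht1 := pair ht ρ₁ hρ₁
  rw [map_mul, map_pow, Circle.coe_mul, Circle.coe_pow, h1x, h1c', h1d] at ht1
  have hτw : ((τ w : Circle) : ℂ) = -1 := by
    have := hωC w
    rw [hwω, hw2] at this
    linear_combination -this
  have hρw := hσC w
  rw [hwσ, hτw] at hρw
  have hr : ((ρ₁ w : Circle) : ℂ) ≠ -1 := by
    intro h
    rw [h] at hρw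
    norm_num at hρw
  rcases ht1 with h | h | h
  · exact hr (by linear_combination h)
  · norm_num at h
  · exact hr (by linear_combination -h)

end Linkage

/-! ### Products of linked triples -/

section Linkage

variable {G : Type*} [CommGroup G] {n : ℕ} {e : G} {X : Set (Character G)}

/-- Comparison of discriminants. It needs values ±1: 1 + (-1) = i + (-i), but the products differ.
-/
theorem FormEquiv.mul_eq_of_sq {b c d : G} (h : FormEquiv X [1, b] [c, d]) {χ : Character G}
    (hχ : χ ∈ X) (hχ2 : χ ^ 2 = 1) : χ c * χ d = χ b := by
  have hc : χ c ^ 2 = 1 := DFunLike.congr_fun hχ2 c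
  rcases h.pair_values hχ with h0 | ⟨h1, h2⟩ | ⟨h1, h2⟩
  · have hs := h.2 χ hχ
    simp only [sgn_cons, sgn_nil, map_one, Circle.coe_one] at hs h0
    have hcC : ((χ c : Circle) : ℂ) ^ 2 = 1 := by rw [← Circle.coe_pow, hc, Circle.coe_one]
    apply Circle.ext
    rw [Circle.coe_mul]
    linear_combination (-((χ c : Circle) : ℂ)) * hs + (((χ c : Circle) : ℂ) - 1) * h0 - hcC
  · rw [h1, h2, map_one, one_mul]
  · rw [h1, h2, map_one, mul_one]

theorem FormEquiv.one_neg {b c d : G} (he : ∀ σ ∈ X, ((σ e : Circle) : ℂ) = -1)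
    (h : FormEquiv X [1, b] [c, d]) : FormEquiv X [1, e * c] [d, e * b] := by
  refine ⟨rfl, fun σ hσ => ?_⟩
  have := h.2 σ hσ
  simp only [sgn_cons, sgn_nil, map_mul, Circle.coe_mul, he σ hσ] at this ⊢
  linear_combination this

/-- Since τ is 1 at b, c and d, the product στω is ρ₁²ρ₂² there. If ρ₁(b)² = ρ₂(b)² = 1, then σ and
ω are 1 at b, hence at c. Otherwise both squares are -1, so 1 + ρᵢ(b) ≠ 0 and each ρᵢ matches c, d
with 1, b; equal matchings give the claim and crossed ones are impossible. -/
theorem IsSpaceOfSignatures.apply_eq_one_of_linked_of_eq_one (hX : IsSpaceOfSignatures n e X)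
    {σ τ ω ρ₁ ρ₂ : Character G} (hσ : σ ∈ X) (hτ : τ ∈ X) (hω : ω ∈ X) (hρ₁ : ρ₁ ∈ X)
    (hρ₂ : ρ₂ ∈ X) (hσ2 : σ ^ 2 = 1) (hσρ : ∀ g, σ g = τ g * ρ₁ g ^ 2)
    (hωρ : ∀ g, ω g = τ g * ρ₂ g ^ 2) {b c d : G} (h : FormEquiv X [1, b] [c, d])
    (hτb : τ b = 1) (hυb : (σ * τ * ω) b = 1) : (σ * τ * ω) c = 1 := by
  have hτcd : τ c = 1 ∧ τ d = 1 := by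
    rcases h.pair_values hτ with h0 | h0 | h0
    · simp [hτb] at h0
    all_goals simp [h0, hτb]
  obtain ⟨hτc, hτd⟩ := hτcd
  simp only [MonoidHom.mul_apply, hσρ, hωρ, hτb, hτc, one_mul, mul_one] at hυb ⊢
  have hone : ∀ ρ ∈ X, ∀ χ ∈ X, (∀ g, χ g = τ g * ρ g ^ 2) → ρ b ^ 2 = 1 → ρ c ^ 2 = 1 := by
    intro ρ _ χ hχ hχρ hb
    have hχb : χ b = 1 := by rw [hχρ, hb, hτb, one_mul]
    have hχc : χ c = 1 := by
      rcases h.pair_values hχ with h0 | h0 | h0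
      · simp [hχb] at h0
      all_goals simp [h0, hχb]
    rwa [hχρ, hτc, one_mul] at hχc
  by_cases hP : ρ₁ b ^ 2 = 1
  · have hQ : ρ₂ b ^ 2 = 1 := by rwa [hP, one_mul] at hυb
    rw [hone ρ₁ hρ₁ σ hσ hσρ hP, hone ρ₂ hρ₂ ω hω hωρ hQ, one_mul]
  · have hsq : (ρ₁ b ^ 2) ^ 2 = 1 := by
      have h1 : σ b ^ 2 = 1 := DFunLike.congr_fun hσ2 b
      rwa [hσρ, hτb, one_mul] at h1
    have hPC : ((ρ₁ b : Circle) : ℂ) ^ 2 = -1 := by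
      rw [← Circle.coe_pow]
      exact eq_neg_one_of_sq hsq hP
    have hQC : ((ρ₂ b : Circle) : ℂ) ^ 2 = -1 := by
      have h1 := congrArg (fun z : Circle => (z : ℂ)) hυb
      simp only [Circle.coe_mul, Circle.coe_pow, Circle.coe_one, hPC] at h1
      linear_combination -h1
    have hpair : ∀ ρ ∈ X, ((ρ b : Circle) : ℂ) ^ 2 = -1 →
        (ρ c = 1 ∧ ρ d = ρ b) ∨ (ρ c = ρ b ∧ ρ d = 1) := by
      intro ρ hρ hb
      rcases h.pair_values hρ with h0 | h0 | h0
      · rw [map_one, Circle.coe_one] at h0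
        have h1 : ((ρ b : Circle) : ℂ) = -1 := by linear_combination h0
        rw [h1] at hb
        norm_num at hb
      · simpa using Or.inl h0
      · simpa using Or.inr h0
    rcases hpair ρ₁ hρ₁ hPC with ⟨h1c, h1d⟩ | ⟨h1c, h1d⟩ <;>
      rcases hpair ρ₂ hρ₂ hQC with ⟨h2c, h2d⟩ | ⟨h2c, h2d⟩
    · simp [h1c, h2c]
    · exact (hX.false_of_pair hσ hω hρ₁ hρ₂ hσρ hωρ h hτc hτd h1c (by rwa [h1d])
        (by rwa [h2c]) h2d).elim
    · exact (hX.false_of_pair hσ hω hρ₁ hρ₂ hσρ hωρ h.swap hτd hτc h1d (by rwa [h1c])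
        (by rwa [h2d]) h2c).elim
    · rwa [h1c, h2c]

/-- If `σ ∼ τ` and `τ ∼ ω` for characters of exponent two, then `στω` belongs to the space. -/
theorem IsSpaceOfSignatures.mul_mul_mem_of_linked (hn : 1 ≤ n) (hX : IsSpaceOfSignatures n e X)
    {σ τ ω : Character G} (hσ : σ ∈ X) (hτ : τ ∈ X) (hω : ω ∈ X) (hσ2 : σ ^ 2 = 1)
    (hτ2 : τ ^ 2 = 1) (hω2 : ω ^ 2 = 1) (hστ : Linked X σ τ) (hτω : Linked X τ ω) :
    σ * τ * ω ∈ X := by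
  obtain ⟨ρ₁, hρ₁, hστ⟩ := hστ
  obtain ⟨ρ₂, hρ₂, hτω⟩ := hτω
  have hσρ : ∀ g, σ g = τ g * ρ₁ g ^ 2 := by
    have h : σ = τ * ρ₁ ^ 2 := by rw [← hστ, mul_left_comm, ← sq, hτ2, mul_one]
    exact DFunLike.congr_fun h
  have hωρ : ∀ g, ω g = τ g * ρ₂ g ^ 2 := by
    have h : ω = τ * ρ₂ ^ 2 := by rw [← hτω, ← mul_assoc, ← sq, hτ2, one_mul]
    exact DFunLike.congr_fun h
  set υ := σ * τ * ω with hυ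
  have hυ2 : υ ^ 2 = 1 := by rw [hυ, mul_pow, mul_pow, hσ2, hτ2, hω2, one_mul, one_mul]
  have hυe : ((υ e : Circle) : ℂ) = -1 := by
    simp [hυ, hX.map_neg_one σ hσ, hX.map_neg_one τ hτ, hX.map_neg_one ω hω]
  have hυec : ∀ g, υ g ≠ 1 → υ (e * g) = 1 := by
    intro g hg
    apply Circle.ext
    rw [map_mul, Circle.coe_mul, hυe, eq_neg_one_of_sq (DFunLike.congr_fun hυ2 g) hg]
    norm_num
  have hτec : ∀ g, τ g ≠ 1 → τ (e * g) = 1 := by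
    intro g hg
    apply Circle.ext
    rw [map_mul, Circle.coe_mul, hX.map_neg_one τ hτ,
      eq_neg_one_of_sq (DFunLike.congr_fun hτ2 g) hg]
    norm_num
  have hυcd : ∀ {b c d : G}, FormEquiv X [1, b] [c, d] → υ c * υ d = υ b := by
    intro b c d h
    rw [hυ]
    simp only [MonoidHom.mul_apply]
    rw [← h.mul_eq_of_sq hσ hσ2, ← h.mul_eq_of_sq hτ hτ2, ← h.mul_eq_of_sq hω hω2]
    simp only [mul_assoc, mul_left_comm]
  have caseA : ∀ {b c d : G}, FormEquiv X [1, b] [c, d] → τ b = 1 → υ b = 1 → υ c = 1 :=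
    fun h => hX.apply_eq_one_of_linked_of_eq_one hσ hτ hω hρ₁ hρ₂ hσ2 hσρ hωρ h
  -- If τ and υ are both -1 at c, they are 1 at -c; the case already settled, applied to 1 - c = -b
  -- + d, gives υ(-b) = 1.
  have hneg : ∀ {b c d : G}, FormEquiv X [1, b] [c, d] → υ b = 1 → τ c ≠ 1 → υ c = 1 := by
    intro b c d h hb hτc
    by_contra hc
    have h1 := caseA (h.one_neg hX.map_neg_one).swap (hτec c hτc) (hυec c hc)
    have h2 := congrArg (fun z : Circle => (z : ℂ)) h1
    simp [hυe, hb] at h2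
    norm_num at h2
  have hall : ∀ {b c d : G}, FormEquiv X [1, b] [c, d] → υ b = 1 → υ c = 1 := by
    intro b c d h hb
    by_cases hτb : τ b = 1
    · exact caseA h hτb hb
    -- As τ(c)τ(d) = τ(b) = -1, one of c, d has value -1 at τ and falls under `hneg`; `hυcd`
    -- transfers the result from d to c.
    by_cases hτc : τ c = 1
    · have hτd : τ d ≠ 1 := by
        intro hτd
        rw [← h.mul_eq_of_sq hτ hτ2, hτc, hτd, one_mul] at hτb
        exact hτb rfl
      have h1 := hυcd h
      rwa [hneg h.swap hb hτd, hb, mul_one] at h1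
    · exact hneg h hb hτc
  refine hX.mem_of_ker hn hυ2 hυe fun a b c ha hb hc => ?_
  obtain ⟨d, hd⟩ := mem_represented_pair.1 hc
  have h := hd.mul_pair a⁻¹
  rw [inv_mul_cancel] at h
  have h1 := hall h (by rw [map_mul, map_inv, ha, hb, inv_one, one_mul])
  rwa [map_mul, map_inv, ha, inv_one, one_mul] at h1

end Linkage

/-! ### Finite duality in exponent two -/

section Duality

variable {G : Type*} [CommGroup G]

/-- Induction on `F`: passing to the characters in `H` trivial at `a` enlarges the common kernel
only by `a`, so a υ with υ(a) = 1 remains trivial on it. -/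
theorem exists_mem_agree_on_finset (F : Finset G) (H : Subgroup (Character G))
    (hH : ∀ h ∈ H, h ^ 2 = 1) (υ : Character G)
    (hυ : ∀ g : G, (∀ h ∈ H, h g = 1) → υ g = 1) : ∃ h ∈ H, ∀ a ∈ F, h a = υ a := by
  classical
  have hval : ∀ χ : Character G, χ ^ 2 = 1 → ∀ g, χ g ≠ 1 → ((χ g : Circle) : ℂ) = -1 :=
    fun χ hχ g hg => eq_neg_one_of_sq (DFunLike.congr_fun hχ g) hg
  have hprod : ∀ z w : Circle, (z : ℂ) = -1 → (w : ℂ) = -1 → z * w = 1 := by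
    intro z w hz hw
    apply Circle.ext
    rw [Circle.coe_mul, hz, hw]
    norm_num
  induction F using Finset.induction_on generalizing H υ with
  | empty => exact ⟨1, H.one_mem, by simp⟩
  | insert a F _ ih =>
    by_cases hall : ∀ h ∈ H, h a = 1
    · obtain ⟨h, hh, hF⟩ := ih H hH υ hυ
      refine ⟨h, hh, fun b hb => ?_⟩
      rcases Finset.mem_insert.1 hb with rfl | hb
      · rw [hall h hh, hυ b hall]
      · exact hF b hb
    push Not at hall
    obtain ⟨h₀, hh₀, h₀a⟩ := hall
    have h₀aC := hval h₀ (hH h₀ hh₀) a h₀a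
    have claim : ∀ υ : Character G, (∀ g : G, (∀ h ∈ H, h g = 1) → υ g = 1) → υ a = 1 →
        ∃ h ∈ H, ∀ b ∈ insert a F, h b = υ b := by
      intro υ hυ hυa
      have hmul : ∀ h ∈ H, h a ≠ 1 → h * h₀ ∈ H ⊓ (MonoidHom.eval a).ker := by
        intro h hh ha
        exact ⟨H.mul_mem hh hh₀, hprod _ _ (hval h (hH h hh) a ha) h₀aC⟩
      obtain ⟨h, hh, hF⟩ := ih (H ⊓ (MonoidHom.eval a).ker) (fun h hh => hH h hh.1) υ (by
        intro g hg
        by_cases h₀g : h₀ g = 1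
        · apply hυ
          intro h hh
          by_cases ha : h a = 1
          · exact hg h ⟨hh, ha⟩
          · have := hg _ (hmul h hh ha)
            rwa [MonoidHom.mul_apply, h₀g, mul_one] at this
        · have h1 : υ (g * a) = 1 := by
            apply hυ
            intro h hh
            rw [map_mul]
            by_cases ha : h a = 1
            · rw [ha, hg h ⟨hh, ha⟩, one_mul]
            · have h2 := hg _ (hmul h hh ha)
              rw [MonoidHom.mul_apply] at h2
              have h3 : h g ≠ 1 := by
                intro h3
                rw [h3, one_mul] at h2
                exact h₀g h2
              exact hprod _ _ (hval h (hH h hh) g h3) (hval h (hH h hh) a ha)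
          rwa [map_mul, hυa, mul_one] at h1)
      refine ⟨h, hh.1, fun b hb => ?_⟩
      rcases Finset.mem_insert.1 hb with rfl | hb
      · rw [hυa]
        exact hh.2
      · exact hF b hb
    by_cases hυa : υ a = 1
    · exact claim υ hυ hυa
    -- Here υ(a) = -1; twisting by `h₀` returns to the case settled by `claim`.
    · have hυ2 : υ a ^ 2 = 1 := by
        rw [← map_pow]
        apply hυ
        intro h hh
        rw [map_pow]
        exact DFunLike.congr_fun (hH h hh) a
      obtain ⟨h, hh, hF⟩ := claim (υ * h₀)
        (fun g hg => by rw [MonoidHom.mul_apply, hυ g hg, hg h₀ hh₀, one_mul])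
        (hprod _ _ (eq_neg_one_of_sq hυ2 hυa) h₀aC)
      refine ⟨h * h₀, H.mul_mem hh hh₀, fun b hb => ?_⟩
      have hb2 : h₀ b ^ 2 = 1 := DFunLike.congr_fun (hH h₀ hh₀) b
      rw [MonoidHom.mul_apply, hF b hb, MonoidHom.mul_apply, mul_assoc, ← sq, hb2, mul_one]

end Duality

/-! ### Fans as full sets of characters -/

section Fan

variable {G : Type*} [CommGroup G] {e : G} {X : Set (Character G)}

/-- Evaluation at `g`, as a character of the group of characters that are trivial on `e`. -/
noncomputable def evalHom (e g : G) : (MonoidHom.eval e : Character G →* Circle).ker →* ℂ :=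
  Circle.coeHom.comp ((MonoidHom.eval g : Character G →* Circle).comp (Subgroup.subtype _))

/-- The combination of the evaluations at the entries of a form, with coefficients `χ a`. -/
noncomputable def evalSum (e : G) (χ : Character G) (f : List G) :
    ((MonoidHom.eval e : Character G →* Circle).ker →* ℂ) →₀ ℂ :=
  (f.map fun a => Finsupp.single (evalHom e a) ((χ a : Circle) : ℂ)).sum

theorem linearCombination_evalSum (χ : Character G) (f : List G)
    (κ : (MonoidHom.eval e : Character G →* Circle).ker) :
    Finsupp.linearCombination ℂ
      (fun φ : (MonoidHom.eval e : Character G →* Circle).ker →* ℂ =>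
        (φ : (MonoidHom.eval e : Character G →* Circle).ker → ℂ)) (evalSum e χ f) κ =
      sgn (χ * (κ : Character G)) f := by
  induction f with
  | nil => simp [evalSum]
  | cons a f ih =>
    have : evalSum e χ (a :: f) = Finsupp.single (evalHom e a) ((χ a : Circle) : ℂ) +
      evalSum e χ f := by simp [evalSum]
    rw [this, map_add, Pi.add_apply, ih, sgn_cons, Finsupp.linearCombination_single]
    simp [evalHom, Circle.coeHom]
    rfl

/-- `X` is a coset of the characters trivial at `e`, so equal evaluations make σ(yx) constant on
`X`; separation then gives yx = 1 or e·yx = 1. -/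
theorem evalHom_eq_iff (hG : ∀ g : G, g ^ 2 = 1)
    (hX : X = {σ : Character G | ((σ e : Circle) : ℂ) = -1})
    (hsep : ∀ g : G, (∀ σ ∈ X, σ g = 1) → g = 1) {χ : Character G} (hχ : χ ∈ X) {x y : G} :
    evalHom e y = evalHom e x ↔ y = x ∨ y = e * x := by
  have hxx : x * x = 1 := by rw [← sq, hG]
  have hee : e * e = 1 := by rw [← sq, hG]
  have hχe : ((χ e : Circle) : ℂ) = -1 := by rwa [hX] at hχ
  constructor
  · intro h
    have hκ : ∀ κ : Character G, κ e = 1 → κ (y * x) = 1 := by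
      intro κ hκ
      have h1 : κ y = κ x := Circle.ext (DFunLike.congr_fun h
        (⟨κ, hκ⟩ : (MonoidHom.eval e : Character G →* Circle).ker) :)
      rw [map_mul, h1, ← map_mul, hxx, map_one]
    have hall : ∀ σ ∈ X, σ (y * x) = χ (y * x) := by
      intro σ hσ
      have h1 := hκ (σ * χ⁻¹) (by
        have hσe : ((σ e : Circle) : ℂ) = -1 := by rwa [hX] at hσ
        apply Circle.ext
        simp [hσe, hχe])
      rwa [MonoidHom.mul_apply, MonoidHom.inv_apply, mul_inv_eq_one] at h1
    by_cases h1 : χ (y * x) = 1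
    · left
      have h2 := hsep (y * x) fun σ hσ => by rw [hall σ hσ, h1]
      rw [← mul_one y, ← hxx, ← mul_assoc, h2, one_mul]
    · right
      have h3 : ((χ (y * x) : Circle) : ℂ) = -1 :=
        eq_neg_one_of_sq (by rw [← map_pow, hG, map_one]) h1
      have h2 := hsep (e * (y * x)) fun σ hσ => by
        have hσe : ((σ e : Circle) : ℂ) = -1 := by rwa [hX] at hσ
        apply Circle.ext
        rw [map_mul, Circle.coe_mul, hall σ hσ, h3, hσe]
        norm_num
      calc y = e * e * y * (x * x) := by rw [hee, hxx, one_mul, mul_one]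
        _ = e * (y * x) * (e * x) := by simp only [mul_assoc, mul_left_comm]
        _ = e * x := by rw [h2, one_mul]
  · rintro (rfl | rfl)
    · rfl
    · ext κ
      have hκ : (κ : Character G) e = 1 := κ.2
      simp [evalHom, hκ]

open Classical in
-- The evaluations at x and ex coincide while their coefficients are opposite, so only the signed
-- multiplicity survives.
theorem evalSum_apply (hG : ∀ g : G, g ^ 2 = 1)
    (hX : X = {σ : Character G | ((σ e : Circle) : ℂ) = -1})
    (hsep : ∀ g : G, (∀ σ ∈ X, σ g = 1) → g = 1) {χ : Character G} (hχ : χ ∈ X) (x : G)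
    (f : List G) :
    evalSum e χ f (evalHom e x) = ((f.count x : ℂ) - f.count (e * x)) * χ x := by
  have hχe : ((χ e : Circle) : ℂ) = -1 := by rwa [hX] at hχ
  have hne : x ≠ e * x := by
    intro h
    have h1 : e = 1 := by simpa using h.symm
    rw [h1, map_one, Circle.coe_one] at hχe
    norm_num at hχe
  induction f with
  | nil => simp [evalSum]
  | cons a f ih =>
    have : evalSum e χ (a :: f) = Finsupp.single (evalHom e a) ((χ a : Circle) : ℂ) +
      evalSum e χ f := by simp [evalSum]
    rw [this, Finsupp.add_apply, ih, Finsupp.single_apply, List.count_cons, List.count_cons]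
    simp only [evalHom_eq_iff hG hX hsep hχ, beq_iff_eq]
    by_cases h1 : a = x
    · subst h1
      simp only [true_or, if_true, hne, if_false]
      push_cast
      ring
    · by_cases h2 : a = e * x
      · subst h2
        simp only [hne.symm, or_true, if_true, if_false, map_mul, Circle.coe_mul, hχe]
        push_cast
        ring
      · simp [h1, h2]

/-- Linear independence of characters: signatures determine signed multiplicities, and that of x in
`f` is positive. -/
theorem mem_of_sgn_eq (hG : ∀ g : G, g ^ 2 = 1)
    (hX : X = {σ : Character G | ((σ e : Circle) : ℂ) = -1})
    (hsep : ∀ g : G, (∀ σ ∈ X, σ g = 1) → g = 1) (hne : X.Nonempty) {f g : List G}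
    (h : ∀ σ ∈ X, sgn σ f = sgn σ g) {x : G} (hx : x ∈ f) (hex : e * x ∉ f) : x ∈ g := by
  classical
  obtain ⟨χ, hχ⟩ := hne
  have heq : evalSum e χ f = evalSum e χ g := by
    apply linearIndependent_monoidHom (MonoidHom.eval e : Character G →* Circle).ker ℂ
    funext κ
    rw [linearCombination_evalSum, linearCombination_evalSum]
    apply h
    rw [hX] at hχ ⊢
    have hκ : (κ : Character G) e = 1 := κ.2
    simpa [hκ] using hχ
  have h1 := DFunLike.congr_fun heq (evalHom e x)
  rw [evalSum_apply hG hX hsep hχ, evalSum_apply hG hX hsep hχ] at h1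
  have h2 := mul_right_cancel₀ (Circle.coe_ne_zero _) h1
  rw [List.count_eq_zero_of_not_mem hex] at h2
  by_contra hxg
  rw [List.count_eq_zero_of_not_mem hxg] at h2
  have h3 : ((f.count x + g.count (e * x) : ℕ) : ℂ) = 0 := by
    push_cast at h2 ⊢
    linear_combination h2
  have h4 := List.count_pos_iff.2 hx
  have h5 := Nat.cast_eq_zero.1 h3
  omega

theorem perm_of_sgn_eq (hG : ∀ g : G, g ^ 2 = 1)
    (hX : X = {σ : Character G | ((σ e : Circle) : ℂ) = -1})
    (hsep : ∀ g : G, (∀ σ ∈ X, σ g = 1) → g = 1) (hne : X.Nonempty) {f g : List G}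
    (h : FormEquiv X f g) (hf : ∀ x ∈ f, e * x ∉ f) : f.Perm g := by
  classical
  induction f generalizing g with
  | nil =>
    rw [List.eq_nil_of_length_eq_zero h.1.symm]
  | cons x f ih =>
    have hx := mem_of_sgn_eq hG hX hsep hne h.2 List.mem_cons_self (hf x List.mem_cons_self)
    have hp := List.perm_cons_erase hx
    refine List.Perm.trans (List.Perm.cons x (ih ⟨?_, fun σ hσ => ?_⟩ fun y hy hey => ?_)) hp.symm
    · have h1 := h.1.trans hp.length_eq
      simpa using h1
    · have h1 := (h.2 σ hσ).trans (sgn_perm σ hp)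
      simpa using h1
    · exact hf y (List.mem_cons_of_mem _ hy) (List.mem_cons_of_mem _ hey)

theorem mem_represented_of_mem {X : Set (Character G)} {f : List G} {a : G} (h : a ∈ f) :
    a ∈ represented X f := by
  classical
  have hp := List.perm_cons_erase h
  exact ⟨f.erase a, hp.length_eq, fun σ _ => sgn_perm σ hp⟩

theorem mem_represented_of_hyperbolic {X : Set (Character G)}
    (he : ∀ σ ∈ X, ((σ e : Circle) : ℂ) = -1) {f : List G} {x : G} (hne : e * x ≠ x)
    (hx : x ∈ f) (hex : e * x ∈ f) (a : G) : a ∈ represented X f := by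
  classical
  have hp := List.perm_cons_erase hx
  have hp' := List.perm_cons_erase ((List.mem_erase_of_ne hne).2 hex)
  have hp'' := hp.trans (hp'.cons x)
  refine ⟨(e * a) :: (f.erase x).erase (e * x), ?_, fun σ hσ => ?_⟩
  · simpa using hp''.length_eq
  · rw [sgn_perm σ hp'']
    simp [he σ hσ]

theorem represented_append_of_mem {X : Set (Character G)} {f g : List G} {x y a : G}
    (hx : x ∈ represented X f) (hy : y ∈ represented X g) (ha : a ∈ represented X [x, y]) :
    a ∈ represented X (f ++ g) := by
  obtain ⟨f', hf', hf⟩ := hx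
  obtain ⟨g', hg', hg⟩ := hy
  obtain ⟨k, hk', hk⟩ := ha
  refine ⟨k ++ (f' ++ g'), ?_, fun σ hσ => ?_⟩
  · simp only [List.length_cons, List.length_append, List.length_nil] at *
    omega
  · have h1 := hf σ hσ
    have h2 := hg σ hσ
    have h3 := hk σ hσ
    simp only [sgn_cons, sgn_nil, sgn_append] at *
    linear_combination h1 + h2 + h3

/-- In exponent two, the set of all characters with `σ(-1) = -1` is a fan as soon as it separates
the elements of the group. -/
theorem isFan_of_separating (hG : ∀ g : G, g ^ 2 = 1)
    (hX : X = {σ : Character G | ((σ e : Circle) : ℂ) = -1})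
    (hsep : ∀ g : G, (∀ σ ∈ X, σ g = 1) → g = 1) (hne : X.Nonempty) : IsFan e X := by
  have he : ∀ σ ∈ X, ((σ e : Circle) : ℂ) = -1 := fun σ hσ => by rwa [hX] at hσ
  have hex : ∀ x : G, e * x ≠ x := by
    intro x h
    obtain ⟨χ, hχ⟩ := hne
    have h1 : e = 1 := by simpa using h
    have h2 := he χ hχ
    rw [h1, map_one, Circle.coe_one] at h2
    norm_num at h2
  refine ⟨⟨fun g => by simpa using hG g, fun σ hσ k hk => ?_, ?_, he, hsep, ?_⟩, hX⟩
  · obtain ⟨m, rfl⟩ := hk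
    have : σ ^ (2 * m + 1) = σ := by
      ext g
      have : σ g ^ 2 = 1 := by rw [← map_pow, hG, map_one]
      rw [MonoidHom.pow_apply, pow_succ, pow_mul, this, one_pow, one_mul]
    rwa [this]
  · rw [hX]
    exact isClosed_eq (continuous_subtype_val.comp (continuous_eval_character e)) continuous_const
  · intro f g hf hg
    apply Set.Subset.antisymm
    · intro a ha
      obtain ⟨u, hu⟩ := List.exists_mem_of_ne_nil f hf
      obtain ⟨v, hv⟩ := List.exists_mem_of_ne_nil g hg
      simp only [Set.mem_iUnion, exists_prop]
      -- Without a pair x, ex a form represents only its entries; with such a pair it represents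
      -- everything.
      by_cases hpair : ∀ x ∈ f ++ g, e * x ∉ f ++ g
      · obtain ⟨k, hk⟩ := ha
        have hmem : a ∈ f ++ g :=
          (perm_of_sgn_eq hG hX hsep hne hk hpair).mem_iff.2 List.mem_cons_self
        rcases List.mem_append.1 hmem with h | h
        · exact ⟨a, mem_represented_of_mem h, v, mem_represented_of_mem hv,
            mem_represented_of_mem (by simp)⟩
        · exact ⟨u, mem_represented_of_mem hu, a, mem_represented_of_mem h,
            mem_represented_of_mem (by simp)⟩
      · push Not at hpair
        obtain ⟨x, hx, hx'⟩ := hpair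
        rcases List.mem_append.1 hx with hx | hx <;> rcases List.mem_append.1 hx' with hx' | hx'
        · exact ⟨a, mem_represented_of_hyperbolic he (hex x) hx hx' a, v,
            mem_represented_of_mem hv, mem_represented_of_mem (by simp)⟩
        · exact ⟨x, mem_represented_of_mem hx, e * x, mem_represented_of_mem hx',
            mem_represented_of_hyperbolic he (hex x) (by simp) (by simp) a⟩
        · exact ⟨e * x, mem_represented_of_mem hx', x, mem_represented_of_mem hx,
            mem_represented_of_hyperbolic he (hex x) (by simp) (by simp) a⟩
        · exact ⟨u, mem_represented_of_mem hu, a,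
            mem_represented_of_hyperbolic he (hex x) hx hx' a, mem_represented_of_mem (by simp)⟩
    · intro a ha
      simp only [Set.mem_iUnion, exists_prop] at ha
      obtain ⟨x, hx, y, hy, ha⟩ := ha
      exact represented_append_of_mem hx hy ha

end Fan

/-! ### Fans and triple products -/

section FanSubset

variable {G : Type*} [CommGroup G] {e : G} {Y : Set (Character G)}

theorem mem_perp {g : G} : g ∈ perp Y ↔ ∀ σ ∈ Y, σ g = 1 := by
  simp [perp, Subgroup.mem_iInf]

/-- A character that is trivial on `Y^⊥`, as a character of `G / Y^⊥`. -/
noncomputable def descendHom (σ : Character G) (hσ : ∀ g ∈ perp Y, σ g = 1) :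
    Character (G ⧸ perp Y) :=
  QuotientGroup.lift (perp Y) σ hσ

theorem descendHom_comp (σ : Character G) (hσ : ∀ g ∈ perp Y, σ g = 1) :
    (descendHom σ hσ).comp (QuotientGroup.mk' (perp Y)) = σ := by
  ext g
  rfl

theorem descendHom_mem {σ : Character G} (h : σ ∈ Y) :
    descendHom σ (fun _ hg => mem_perp.1 hg σ h) ∈ descend Y := by
  change (descendHom σ _).comp (QuotientGroup.mk' (perp Y)) ∈ Y
  rwa [descendHom_comp]

/-- The product of three elements of a fan belongs to the fan. -/
theorem IsFanSubset.mul_mul_mem (h : IsFanSubset e Y) {σ τ ω : Character G} (hσ : σ ∈ Y)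
    (hτ : τ ∈ Y) (hω : ω ∈ Y) : σ * τ * ω ∈ Y := by
  have htriv : ∀ g ∈ perp Y, (σ * τ * ω) g = 1 := by
    intro g hg
    rw [mem_perp] at hg
    simp [hg σ hσ, hg τ hτ, hg ω hω]
  have he : ∀ χ ∈ Y, ((χ e : Circle) : ℂ) = -1 := fun χ hχ =>
    h.1.map_neg_one _ (descendHom_mem hχ)
  have hmem : descendHom (σ * τ * ω) htriv ∈ descend Y := by
    rw [h.2]
    change (((σ * τ * ω) e : Circle) : ℂ) = -1
    simp [he σ hσ, he τ hτ, he ω hω]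
  have h1 : (descendHom (σ * τ * ω) htriv).comp (QuotientGroup.mk' (perp Y)) ∈ Y := hmem
  rwa [descendHom_comp] at h1

/-- A nonempty closed set of characters of exponent two with `σ(-1) = -1` that is closed under
products of three elements is a fan. -/
theorem isFanSubset_of_mul_mul_mem (hY : IsClosed Y) (hne : Y.Nonempty)
    (h2 : ∀ σ ∈ Y, σ ^ 2 = 1) (he : ∀ σ ∈ Y, ((σ e : Circle) : ℂ) = -1)
    (hmul : ∀ σ ∈ Y, ∀ τ ∈ Y, ∀ ω ∈ Y, σ * τ * ω ∈ Y) : IsFanSubset e Y := by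
  obtain ⟨σ₀, hσ₀⟩ := hne
  have hσ₀2 : σ₀ * σ₀ = 1 := by rw [← sq, h2 σ₀ hσ₀]
  refine isFan_of_separating ?_ ?_ ?_ ⟨_, descendHom_mem hσ₀⟩
  · intro z
    obtain ⟨g, rfl⟩ := QuotientGroup.mk'_surjective (perp Y) z
    rw [← map_pow, QuotientGroup.mk'_apply, QuotientGroup.eq_one_iff, mem_perp]
    intro σ hσ
    rw [map_pow]
    exact DFunLike.congr_fun (h2 σ hσ) g
  · ext χ
    constructor
    · exact fun hχ => he _ hχ
    · intro hχ
      have hperp : ∀ g ∈ perp Y, χ (QuotientGroup.mk' (perp Y) g) = 1 := by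
        intro g hg
        rw [QuotientGroup.mk'_apply, (QuotientGroup.eq_one_iff g).2 hg, map_one]
      -- The translate of `Y` by σ₀ is a group exactly because of closure under triple products.
      let H : Subgroup (Character G) :=
        { carrier := {h | h * σ₀ ∈ Y}
          one_mem' := by simpa using hσ₀
          mul_mem' := by
            intro a b ha hb
            have h1 := hmul _ ha _ hσ₀ _ hb
            have h3 : a * σ₀ * σ₀ * (b * σ₀) = a * b * σ₀ := by
              rw [mul_assoc a, hσ₀2, mul_one, mul_assoc]
            rwa [h3] at h1
          inv_mem' := by
            intro a ha
            have h1 : (a * σ₀) ^ 2 = 1 := h2 _ ha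
            rw [mul_pow, h2 σ₀ hσ₀, mul_one, sq] at h1
            have h3 : a⁻¹ = a := inv_eq_of_mul_eq_one_left h1
            simpa [h3] using ha }
      refine mem_of_forall_finset_agree hY fun F => ?_
      obtain ⟨h, hh, hF⟩ := exists_mem_agree_on_finset F H (by
          intro h hh
          have h1 : (h * σ₀) ^ 2 = 1 := h2 _ hh
          rwa [mul_pow, h2 σ₀ hσ₀, mul_one] at h1)
        (χ.comp (QuotientGroup.mk' (perp Y)) * σ₀) (by
          intro g hg
          -- Where `H` is trivial, `Y` is constant, so g or eg lies in `perp Y`; in both cases χ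
          -- agrees with σ₀ there.
          have hall : ∀ τ ∈ Y, τ g = σ₀ g := by
            intro τ hτ
            have h1 := hg (τ * σ₀) (by
              change τ * σ₀ * σ₀ ∈ Y
              rwa [mul_assoc, hσ₀2, mul_one])
            have h3 : σ₀ g * σ₀ g = 1 := DFunLike.congr_fun hσ₀2 g
            rw [MonoidHom.mul_apply] at h1
            exact mul_right_cancel (h1.trans h3.symm)
          rw [MonoidHom.mul_apply, MonoidHom.comp_apply]
          by_cases h1 : σ₀ g = 1
          · rw [hperp g (mem_perp.2 fun τ hτ => by rw [hall τ hτ, h1]), h1, one_mul]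
          · have h3 := eq_neg_one_of_sq (DFunLike.congr_fun (h2 σ₀ hσ₀) g) h1
            have h4 := hperp (e * g) (mem_perp.2 fun τ hτ => by
              apply Circle.ext
              rw [map_mul, Circle.coe_mul, hall τ hτ, h3, he τ hτ]
              norm_num)
            rw [map_mul, map_mul] at h4
            have h5 := congrArg (fun z : Circle => (z : ℂ)) h4
            have h6 : ((χ (QuotientGroup.mk' (perp Y) e) : Circle) : ℂ) = -1 := hχ
            simp only [Circle.coe_mul, h6, Circle.coe_one] at h5
            apply Circle.ext
            rw [Circle.coe_mul, h3, Circle.coe_one]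
            linear_combination h5)
      refine ⟨h * σ₀, hh, fun a ha => ?_⟩
      have h3 : σ₀ a * σ₀ a = 1 := DFunLike.congr_fun hσ₀2 a
      rw [MonoidHom.mul_apply, hF a ha, MonoidHom.mul_apply, mul_assoc, h3, mul_one]
  · intro z hz
    obtain ⟨g, rfl⟩ := QuotientGroup.mk'_surjective (perp Y) z
    rw [QuotientGroup.mk'_apply, QuotientGroup.eq_one_iff, mem_perp]
    intro σ hσ
    exact hz _ (descendHom_mem hσ)

end FanSubset

/-! ### The equivalence of the two conditions -/

section Linkage

variable {G : Type*} [CommGroup G] {n : ℕ} {e : G} {X X' : Set (Character G)}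

theorem IsSubspace.subset (h : IsSubspace X' X) : X ⊆ X' := by
  obtain ⟨Δ, rfl⟩ := h
  exact fun σ hσ => hσ.1

theorem IsSubspace.mul_mul_mem (h : IsSubspace X' X) {σ τ ω : Character G} (hσ : σ ∈ X)
    (hτ : τ ∈ X) (hω : ω ∈ X) (hmem : σ * τ * ω ∈ X') : σ * τ * ω ∈ X := by
  obtain ⟨Δ, rfl⟩ := h
  refine ⟨hmem, fun d hd => ?_⟩
  simp [hσ.2 d hd, hτ.2 d hd, hω.2 d hd]

theorem Linked.symm {σ τ : Character G} (h : Linked X' σ τ) : Linked X' τ σ := by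
  rwa [Linked, mul_comm]

theorem Linked.refl {σ : Character G} (h : σ ∈ X') : Linked X' σ σ := ⟨σ, h, (sq σ).symm⟩

theorem OneOrAllLinked.all_of_two (h : OneOrAllLinked X' X) {σ₀ σ₁ σ₂ σ₃ : Character G}
    (h₀ : σ₀ ∈ X) (h₁ : σ₁ ∈ X) (h₂ : σ₂ ∈ X) (h₃ : σ₃ ∈ X) (hprod : σ₀ * σ₁ * σ₂ * σ₃ = 1)
    (h01 : Linked X' σ₀ σ₁) (h02 : Linked X' σ₀ σ₂) : Linked X' σ₀ σ₃ := by
  have := h σ₀ h₀ σ₁ h₁ σ₂ h₂ σ₃ h₃ hprod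
  tauto

theorem mul_mul_mul_self_eq_one {σ τ ω : Character G} (hσ : σ ^ 2 = 1) (hτ : τ ^ 2 = 1)
    (hω : ω ^ 2 = 1) : τ * σ * ω * (σ * τ * ω) = 1 := by
  calc τ * σ * ω * (σ * τ * ω) = σ ^ 2 * τ ^ 2 * ω ^ 2 := by
        simp only [sq, mul_assoc, mul_left_comm]
    _ = 1 := by rw [hσ, hτ, hω, one_mul, one_mul]

/-- Under the condition on quadruples, if `σ ∼ τ` and `τ ∼ ω`, then `στω` belongs to the same
class. -/
theorem OneOrAllLinked.mul_mul (hn : 1 ≤ n) (hX' : IsSpaceOfSignatures n e X')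
    (hX : IsSubspace X' X) (hord : ∀ σ ∈ X, σ ^ 2 = 1) (h : OneOrAllLinked X' X)
    {σ τ ω : Character G} (hσ : σ ∈ X) (hτ : τ ∈ X) (hω : ω ∈ X) (hστ : Linked X' σ τ)
    (hτω : Linked X' τ ω) : σ * τ * ω ∈ X ∧ Linked X' τ (σ * τ * ω) := by
  have hmem : σ * τ * ω ∈ X := hX.mul_mul_mem hσ hτ hω
    (hX'.mul_mul_mem_of_linked hn (hX.subset hσ) (hX.subset hτ) (hX.subset hω) (hord σ hσ)
      (hord τ hτ) (hord ω hω) hστ hτω)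
  exact ⟨hmem, h.all_of_two hτ hσ hω hmem
    (mul_mul_mul_self_eq_one (hord σ hσ) (hord τ hτ) (hord ω hω)) hστ.symm hτω⟩

theorem OneOrAllLinked.trans (hn : 1 ≤ n) (hX' : IsSpaceOfSignatures n e X')
    (hX : IsSubspace X' X) (hord : ∀ σ ∈ X, σ ^ 2 = 1) (h : OneOrAllLinked X' X)
    {σ τ ω : Character G} (hσ : σ ∈ X) (hτ : τ ∈ X) (hω : ω ∈ X) (hστ : Linked X' σ τ)
    (hτω : Linked X' τ ω) : Linked X' σ ω := by
  obtain ⟨ρ, hρ, hρ2⟩ := (h.mul_mul hn hX' hX hord hσ hτ hω hστ hτω).2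
  refine ⟨ρ, hρ, ?_⟩
  rw [← hρ2, mul_left_comm τ, mul_assoc, ← mul_assoc τ, ← sq, hord τ hτ, one_mul]

theorem mem_fibre {s : Setoid X} (hs : ∀ σ τ : X, s σ τ ↔ Linked X' σ τ) {σ : X}
    {τ : Character G} : τ ∈ fibre s σ ↔ τ ∈ X ∧ Linked X' τ σ := by
  constructor
  · rintro ⟨h, hq⟩
    exact ⟨h, (hs ⟨τ, h⟩ σ).1 (Quotient.exact hq)⟩
  · rintro ⟨h, hl⟩
    exact ⟨h, Quotient.sound ((hs ⟨τ, h⟩ σ).2 hl)⟩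

theorem OneOrAllLinked.exists_isPStructure (hn : 1 ≤ n) (hX' : IsSpaceOfSignatures n e X')
    (hX : IsSubspace X' X) (hord : ∀ σ ∈ X, σ ^ 2 = 1) (h : OneOrAllLinked X' X) :
    ∃ s : Setoid X, (∀ σ τ : X, s σ τ ↔ Linked X' σ τ) ∧ IsPStructure e X s := by
  have htrans : ∀ {σ τ ω : Character G}, σ ∈ X → τ ∈ X → ω ∈ X → Linked X' σ τ →
      Linked X' τ ω → Linked X' σ ω := fun hσ hτ hω => h.trans hn hX' hX hord hσ hτ hω
  let s : Setoid X :=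
    { r := fun σ τ => Linked X' σ τ
      iseqv := ⟨fun σ => Linked.refl (hX.subset σ.2), fun h => h.symm,
        fun {σ τ ω} h1 h2 => htrans σ.2 τ.2 ω.2 h1 h2⟩ }
  have hs : ∀ σ τ : X, s σ τ ↔ Linked X' σ τ := fun σ τ => Iff.rfl
  refine ⟨s, hs, ⟨fun σ => ?_, fun σ hσ => ?_⟩⟩
  · apply isFanSubset_of_mul_mul_mem
    · have h1 : fibre s σ = X ∩ (fun τ => (τ, (σ : Character G))) ⁻¹'
          {p : Character G × Character G | Linked X' p.1 p.2} := by
        ext τ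
        exact mem_fibre hs
      rw [h1]
      exact (hX.isClosed hX'.isClosed).inter ((isClosed_setOf_linked hX'.isClosed).preimage
        (continuous_id.prodMk continuous_const))
    · exact ⟨σ, (mem_fibre hs).2 ⟨σ.2, Linked.refl (hX.subset σ.2)⟩⟩
    · exact fun τ hτ => hord τ ((mem_fibre hs).1 hτ).1
    · exact fun τ hτ => hX'.map_neg_one τ (hX.subset ((mem_fibre hs).1 hτ).1)
    · intro α hα β hβ γ hγ
      rw [mem_fibre hs] at hα hβ hγ ⊢
      have hαβ := htrans hα.1 σ.2 hβ.1 hα.2 hβ.2.symm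
      have hβγ := htrans hβ.1 σ.2 hγ.1 hβ.2 hγ.2.symm
      obtain ⟨hmem, hl⟩ := h.mul_mul hn hX' hX hord hα.1 hβ.1 hγ.1 hαβ hβγ
      exact ⟨hmem, htrans hmem hβ.1 σ.2 hl.symm hβ.2⟩
  · have hq : ∀ i j, Linked X' (σ i) (σ j) → Quotient.mk s (σ i) = Quotient.mk s (σ j) :=
      fun i j hl => Quotient.sound hl
    have hprod : (σ 0 : Character G) * σ 1 * σ 2 * σ 3 = 1 := by
      rwa [Fin.prod_univ_four] at hσ
    have two : ∀ a b : Quotient s, (∀ i, Quotient.mk s (σ i) = a ∨ Quotient.mk s (σ i) = b) →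
        (Set.range fun i => Quotient.mk s (σ i)).ncard ≤ 2 := by
      intro a b hab
      refine (Set.ncard_le_ncard (t := {a, b}) ?_ (by simp)).trans (by
        simpa using Set.ncard_insert_le a {b})
      rintro _ ⟨i, rfl⟩
      exact hab i
    have pairs : ∀ i j k : Fin 4, (σ 0 : Character G) * σ i * σ j * σ k = 1 →
        (∀ l, l = 0 ∨ l = i ∨ l = j ∨ l = k) → Linked X' (σ 0) (σ i) →
        ¬ Linked X' (σ 0) (σ j) → ¬ Linked X' (σ 0) (σ k) →
        (Set.range fun i => Quotient.mk s (σ i)).ncard ≤ 2 := by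
      intro i j k hp hl h0i h0j h0k
      -- By transitivity σⱼ is linked to neither σ₀ nor σᵢ, so the condition read at σⱼ leaves only
      -- σₖ.
      have hjk : Linked X' (σ j) (σ k) := by
        have h1 := h (σ j) (σ j).2 (σ 0) (σ 0).2 (σ i) (σ i).2 (σ k) (σ k).2 (by
          rw [← hp]
          simp only [mul_assoc, mul_left_comm])
        have hj0 : ¬ Linked X' (σ j) (σ 0) := fun hl => h0j hl.symm
        have hji : ¬ Linked X' (σ j) (σ i) := fun hl =>
          h0j (htrans (σ 0).2 (σ i).2 (σ j).2 h0i hl.symm)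
        tauto
      refine two (Quotient.mk s (σ 0)) (Quotient.mk s (σ j)) fun l => ?_
      rcases hl l with rfl | rfl | rfl | rfl
      · exact Or.inl rfl
      · exact Or.inl (hq _ _ h0i.symm)
      · exact Or.inr rfl
      · exact Or.inr (hq _ _ hjk.symm)
    rcases h (σ 0) (σ 0).2 (σ 1) (σ 1).2 (σ 2) (σ 2).2 (σ 3) (σ 3).2 hprod with
      (⟨h1, h2, h3⟩ | ⟨h1, h2, h3⟩ | ⟨h1, h2, h3⟩) | ⟨h1, h2, h3⟩
    · exact pairs 1 2 3 hprod (by decide) h1 h2 h3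
    · exact pairs 2 1 3 (by rw [← hprod, mul_right_comm (σ 0 : Character G)]) (by decide) h2 h1 h3
    · exact pairs 3 1 2 (by rw [← hprod]; simp only [mul_assoc, mul_comm, mul_left_comm])
        (by decide) h3 h1 h2
    · refine two (Quotient.mk s (σ 0)) (Quotient.mk s (σ 0)) fun l => Or.inl ?_
      fin_cases l
      · rfl
      · exact hq _ _ h1.symm
      · exact hq _ _ h2.symm
      · exact hq _ _ h3.symm

theorem eq_of_ncard_range_le_two {α : Type*} {f : Fin 4 → α} (hf : (Set.range f).ncard ≤ 2)
    (i j k : Fin 4) : f i = f j ∨ f i = f k ∨ f j = f k := by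
  by_contra! h
  have h3 : ({f i, f j, f k} : Set α).ncard = 3 := Set.ncard_eq_three.2
    ⟨_, _, _, h.1, h.2.1, h.2.2, rfl⟩
  have h4 : ({f i, f j, f k} : Set α) ⊆ Set.range f := by
    rintro x (rfl | rfl | rfl) <;> exact Set.mem_range_self _
  have := Set.ncard_le_ncard h4 (Set.finite_range f)
  omega

theorem IsPStructure.oneOrAllLinked (hord : ∀ σ ∈ X, σ ^ 2 = 1) {s : Setoid X}
    (hs : ∀ σ τ : X, s σ τ ↔ Linked X' σ τ) (hP : IsPStructure e X s) :
    OneOrAllLinked X' X := by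
  have htriple : ∀ α β γ δ : X, (α : Character G) * β * γ * δ = 1 → Linked X' α β →
      Linked X' α γ → Linked X' α δ := by
    intro α β γ δ hp hαβ hαγ
    have hα : (α : Character G) ∈ fibre s α := ⟨α.2, rfl⟩
    have hβ : (β : Character G) ∈ fibre s α := (mem_fibre hs).2 ⟨β.2, hαβ.symm⟩
    have hγ : (γ : Character G) ∈ fibre s α := (mem_fibre hs).2 ⟨γ.2, hαγ.symm⟩
    have h1 := (hP.fibre_isFan α).mul_mul_mem hα hβ hγ
    have h2 : (α : Character G) * β * γ = δ :=
      mul_right_cancel (hp.trans (by rw [← sq, hord δ δ.2]))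
    rw [h2] at h1
    exact ((mem_fibre hs).1 h1).2.symm
  intro σ₀ h₀ σ₁ h₁ σ₂ h₂ σ₃ h₃ hprod
  have htrans : ∀ α β γ : X, Linked X' α β → Linked X' β γ → Linked X' α γ := by
    intro α β γ h1 h2
    exact (hs α γ).1 (s.trans ((hs α β).2 h1) ((hs β γ).2 h2))
  have h123 := htriple ⟨σ₀, h₀⟩ ⟨σ₁, h₁⟩ ⟨σ₂, h₂⟩ ⟨σ₃, h₃⟩ hprod
  have h132 := htriple ⟨σ₀, h₀⟩ ⟨σ₁, h₁⟩ ⟨σ₃, h₃⟩ ⟨σ₂, h₂⟩ (by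
    rw [← hprod, mul_right_comm (σ₀ * σ₁)])
  have h231 := htriple ⟨σ₀, h₀⟩ ⟨σ₂, h₂⟩ ⟨σ₃, h₃⟩ ⟨σ₁, h₁⟩ (by
    rw [← hprod]; simp only [mul_comm, mul_left_comm])
  -- With no link at σ₀, the other three must share the only remaining class, and their product σ₀
  -- would lie in that fan.
  have hsome : Linked X' σ₀ σ₁ ∨ Linked X' σ₀ σ₂ ∨ Linked X' σ₀ σ₃ := by
    by_contra! hno
    have hcard := hP.meets_at_most_two ![⟨σ₀, h₀⟩, ⟨σ₁, h₁⟩, ⟨σ₂, h₂⟩, ⟨σ₃, h₃⟩] (by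
      rw [Fin.prod_univ_four]
      exact hprod)
    have hl : ∀ {α β : X}, Quotient.mk s α = Quotient.mk s β → Linked X' α β :=
      fun hq => (hs _ _).1 (Quotient.exact hq)
    have h12 : Linked X' σ₁ σ₂ := by
      rcases eq_of_ncard_range_le_two hcard 0 1 2 with h | h | h
      · exact absurd (hl h) hno.1
      · exact absurd (hl h) hno.2.1
      · exact hl h
    have h13 : Linked X' σ₁ σ₃ := by
      rcases eq_of_ncard_range_le_two hcard 0 1 3 with h | h | h
      · exact absurd (hl h) hno.1
      · exact absurd (hl h) hno.2.2
      · exact hl h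
    exact hno.1 (htriple ⟨σ₁, h₁⟩ ⟨σ₂, h₂⟩ ⟨σ₃, h₃⟩ ⟨σ₀, h₀⟩ (by
      rw [← hprod]; simp only [mul_comm, mul_left_comm]) h12 h13).symm
  simp only at h123 h132 h231
  tauto

end Linkage

end SignatureSpaces

theorem mainTheorem6 {G : Type*} [CommGroup G] (n : ℕ) (hn : 1 ≤ n) (e : G)
    (X' X : Set (SignatureSpaces.Character G))
    (hX' : SignatureSpaces.IsSpaceOfSignatures n e X')
    (hX : SignatureSpaces.IsSubspace X' X)
    (hord : ∀ σ ∈ X, σ ^ 2 = 1) :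
    ((∃ s : Setoid X, (∀ σ τ : X, s σ τ ↔ SignatureSpaces.Linked X' σ τ) ∧
        SignatureSpaces.IsPStructure e X s) ↔
      SignatureSpaces.OneOrAllLinked X' X) ∧
    ∀ s : Setoid X, (∀ σ τ : X, s σ τ ↔ SignatureSpaces.Linked X' σ τ) →
      SignatureSpaces.IsPStructure e X s → T2Space (Quotient s) :=
  ⟨⟨fun ⟨_, hs, hP⟩ => hP.oneOrAllLinked hord hs,
    fun h => h.exists_isPStructure hn hX' hX hord⟩,
    fun s hs _ => hX.t2Space_quotient hX'.isClosed s hs⟩
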